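/- Throughout, Lie groups are finite-dimensional real smooth manifolds, Hausdorff and second countable, with smooth group operations, and "measurable" means Borel measurable. Let $G$ be a Lie group and let $A$ be a smooth $G$-module, i.e. an abelian Lie group, written additively, with a smooth action $G\times A\to A$ by group automorphisms. For $n=1,2$ let $C^n_{lsm}(G,A)$ be the group of all measurable functions $G^n\to A$ that are smooth on some neighbourhood of the identity of $G^n$. Let $Z^2_{lsm}(G,A)$ be the group of all $F\in C^2_{lsm}(G,A)$ such that $$s\cdot F(t,u)-F(st,u)+F(s,tu)-F(s,t)=0\qquad\text{for all } s,t,u\in G,$$ let $B^2_{lsm}(G,A)$ be the group of all functions $(s,t)\mapsto s\cdot c(t)-c(st)+c(s)$ with $c\in C^1_{lsm}(G,A)$, and let $H^2_{lsm}(G,A)=Z^2_{lsm}(G,A)/B^2_{lsm}(G,A)$. Consider extensions $$0\to A\overset{\imath}{\to}E\overset{\pi}{\to}G\to 1,$$ that is, short exact sequences in which $E$ is a Lie group, $\imath$ and $\pi$ are smooth homomorphisms, $\imath$ is a closed map and $\pi$ is an open map, such that $e\,\imath(a)\,e^{-1}=\imath(\pi(e)\cdot a)$ for all $e\in E$, $a\in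 A$, and such that there is a measurable cross section $\sigma:G\to E$ of $\pi$ that is smooth on a neighbourhood of the identity of $G$. Two extensions $E,E'$ are equivalent if there is an isomorphism of Lie groups $E\to E'$ that induces the identity on $A$ and on $G$. Theorem. There is a bijection from the set of equivalence classes of such extensions onto $H^2_{lsm}(G,A)$ which, for every such extension $E$ and every measurable cross section $\sigma$ of $\pi$ that is smooth around the identity, sends the class of $E$ to the class of the cocycle $F_\sigma\in Z^2_{lsm}(G,A)$ determined by $\imath(F_\sigma(s,t))=\sigma(s)\,\sigma(t)\,\sigma(st)^{-1}$. In particular $F_\sigma$ lies in $Z^2_{lsm}(G,A)$, and its class depends neither on the choice of $\sigma$ nor on the choice of $E$ in its equivalence class. -/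

import Mathlib

open scoped Manifold ContDiff Topology

namespace LocallySmooth

/-- `f : M → N` is *locally smooth measurable* at the point `p`: it is (Borel) measurable on all of
`M`, and it is smooth on some open neighbourhood of `p`. -/
def IsLSM {EM HM M EN HN N : Type*}
    [NormedAddCommGroup EM] [NormedSpace ℝ EM] [TopologicalSpace HM] (I : ModelWithCorners ℝ EM HM)
    [TopologicalSpace M] [ChartedSpace HM M] [MeasurableSpace M]
    [NormedAddCommGroup EN] [NormedSpace ℝ EN] [TopologicalSpace HN] (J : ModelWithCorners ℝ EN HN)
    [TopologicalSpace N] [ChartedSpace HN N] [MeasurableSpace N]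
    (p : M) (f : M → N) : Prop :=
  Measurable f ∧ ∃ U : Set M, IsOpen U ∧ p ∈ U ∧ ContMDiffOn I J ∞ f U

section Cochains

variable {EM HM M EA HA : Type*}
  [NormedAddCommGroup EM] [NormedSpace ℝ EM] [TopologicalSpace HM] (I : ModelWithCorners ℝ EM HM)
  [TopologicalSpace M] [ChartedSpace HM M] [MeasurableSpace M]
  [NormedAddCommGroup EA] [NormedSpace ℝ EA] [TopologicalSpace HA] (J : ModelWithCorners ℝ EA HA)
  (A : Type*) [AddCommGroup A] [TopologicalSpace A] [ChartedSpace HA A] [LieAddGroup J ∞ A]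
  [SecondCountableTopology A] [MeasurableSpace A] [BorelSpace A]

/-- The group of all functions `M → A` that are measurable on `M` and smooth around `p`. -/
noncomputable def lsmFunctions (p : M) : AddSubgroup (M → A) where
  carrier := {f | IsLSM I J p f}
  zero_mem' := ⟨measurable_const, Set.univ, isOpen_univ, Set.mem_univ p, contMDiffOn_const⟩
  add_mem' := by
    rintro f g ⟨hf, U, hU, hpU, hfU⟩ ⟨hg, V, hV, hpV, hgV⟩
    have : IsTopologicalAddGroup A := topologicalAddGroup_of_lieAddGroup J ∞
    exact ⟨hf.add hg, U ∩ V, hU.inter hV, ⟨hpU, hpV⟩,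
      (hfU.mono Set.inter_subset_left).add (hgV.mono Set.inter_subset_right)⟩
  neg_mem' := by
    rintro f ⟨hf, U, hU, hpU, hfU⟩
    have : IsTopologicalAddGroup A := topologicalAddGroup_of_lieAddGroup J ∞
    exact ⟨hf.neg, U, hU, hpU, hfU.neg⟩

end Cochains

section Cohomology

variable {EG HG : Type*} [NormedAddCommGroup EG] [NormedSpace ℝ EG] [TopologicalSpace HG]
  (I : ModelWithCorners ℝ EG HG)
  {EA HA : Type*} [NormedAddCommGroup EA] [NormedSpace ℝ EA] [TopologicalSpace HA]
  (J : ModelWithCorners ℝ EA HA)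
  (G : Type*) [Group G] [TopologicalSpace G] [ChartedSpace HG G] [MeasurableSpace G]
  (A : Type*) [AddCommGroup A] [TopologicalSpace A] [ChartedSpace HA A] [LieAddGroup J ∞ A]
  [SecondCountableTopology A] [MeasurableSpace A] [BorelSpace A] [DistribMulAction G A]

/-- `C¹_lsm(G, A)`: measurable functions `G → A` that are smooth around the identity. -/
noncomputable def C1lsm : AddSubgroup (G → A) := lsmFunctions I J A (1 : G)

/-- `C²_lsm(G, A)`: measurable functions `G × G → A` that are smooth around the identity. -/
noncomputable def C2lsm : AddSubgroup (G × G → A) := lsmFunctions (I.prod I) J A (1 : G × G)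

/-- The coboundary `d¹ : (d¹c)(s, t) = s • c(t) - c(st) + c(s)` on arbitrary functions. -/
def d1 : (G → A) →+ (G × G → A) where
  toFun c := fun p => p.1 • c p.2 - c (p.1 * p.2) + c p.1
  map_zero' := by ext; simp
  map_add' c c' := by ext; simp only [Pi.add_apply, smul_add]; abel

/-- The coboundary
`d² : (d²f)(s, t, u) = s • f(t, u) - f(st, u) + f(s, tu) - f(s, t)` on arbitrary functions. -/
def d2 : (G × G → A) →+ (G × G × G → A) where
  toFun f := fun p => p.1 • f (p.2.1, p.2.2) - f (p.1 * p.2.1, p.2.2)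
    + f (p.1, p.2.1 * p.2.2) - f (p.1, p.2.1)
  map_zero' := by ext; simp
  map_add' f f' := by ext; simp only [Pi.add_apply, smul_add]; abel

/-- `Z²_lsm(G, A)`: the locally smooth measurable `2`-cocycles. -/
noncomputable def Z2lsm : AddSubgroup (G × G → A) := C2lsm I J G A ⊓ (d2 G A).ker

/-- `B²_lsm(G, A)`: the coboundaries of locally smooth measurable `1`-cochains. -/
noncomputable def B2lsm : AddSubgroup (G × G → A) := (C1lsm I J G A).map (d1 G A)

/-- `H²_lsm(G, A) = Z²_lsm(G, A) / B²_lsm(G, A)`. -/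
noncomputable abbrev H2lsm : Type _ := Z2lsm I J G A ⧸ (B2lsm I J G A).addSubgroupOf (Z2lsm I J G A)

end Cohomology

section Extensions

universe u v

variable {EG HG : Type*} [NormedAddCommGroup EG] [NormedSpace ℝ EG] [TopologicalSpace HG]
  (I : ModelWithCorners ℝ EG HG)
  {EA HA : Type*} [NormedAddCommGroup EA] [NormedSpace ℝ EA] [TopologicalSpace HA]
  (J : ModelWithCorners ℝ EA HA)
  (G : Type u) [Group G] [TopologicalSpace G] [ChartedSpace HG G] [MeasurableSpace G]
  (A : Type v) [AddCommGroup A] [TopologicalSpace A] [ChartedSpace HA A] [DistribMulAction G A]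

/-- An extension `0 → A → E → G → 1` of the Lie group `G` by the smooth `G`-module `A`, where `E` is
a (finite-dimensional real, Hausdorff, second countable) Lie group, the homomorphisms are smooth,
`A → E` is a closed map, `E → G` is an open map, conjugation in `E` induces the given action of
`G` on `A`, and there is a measurable cross section `G → E` that is smooth around the identity. -/
structure LieExtension where
  /-- The underlying type of the Lie group `E`. -/
  carrier : Type (max u v)
  [group : Group carrier]
  [topologicalSpace : TopologicalSpace carrier]
  [t2Space : T2Space carrier]
  [secondCountableTopology : SecondCountableTopology carrier]
  [measurableSpace : MeasurableSpace carrier]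
  [borelSpace : BorelSpace carrier]
  /-- The dimension of the Lie group `E`. -/
  dim : ℕ
  [chartedSpace : ChartedSpace (EuclideanSpace ℝ (Fin dim)) carrier]
  [lieGroup : LieGroup (𝓡 dim) ∞ carrier]
  /-- The underlying extension of abstract groups. -/
  ext : GroupExtension (Multiplicative A) carrier G
  contMDiff_inl : ContMDiff J (𝓡 dim) ∞ fun a : A => ext.inl (Multiplicative.ofAdd a)
  isClosedMap_inl : IsClosedMap fun a : A => ext.inl (Multiplicative.ofAdd a)
  contMDiff_rightHom : ContMDiff (𝓡 dim) I ∞ ext.rightHom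
  isOpenMap_rightHom : IsOpenMap ext.rightHom
  conj_inl : ∀ (e : carrier) (a : A),
    e * ext.inl (Multiplicative.ofAdd a) * e⁻¹ =
      ext.inl (Multiplicative.ofAdd (ext.rightHom e • a))
  exists_section : ∃ σ : ext.Section, IsLSM I (𝓡 dim) (1 : G) σ

attribute [instance] LieExtension.group LieExtension.topologicalSpace LieExtension.t2Space
  LieExtension.secondCountableTopology LieExtension.measurableSpace LieExtension.borelSpace
  LieExtension.chartedSpace LieExtension.lieGroup

variable {I J G A} in
/-- Two extensions are equivalent if there is an isomorphism of Lie groups between them that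
induces the identity on `A` and on `G`. -/
def LieExtension.IsEquivalent (X Y : LieExtension I J G A) : Prop :=
  ∃ φ : X.ext.Equiv Y.ext,
    ContMDiff (𝓡 X.dim) (𝓡 Y.dim) ∞ φ ∧ ContMDiff (𝓡 Y.dim) (𝓡 X.dim) ∞ φ.symm

/-- Equivalence of extensions, as an equivalence relation. -/
def LieExtension.setoid : Setoid (LieExtension I J G A) where
  r := LieExtension.IsEquivalent
  iseqv :=
    { refl := fun X => ⟨GroupExtension.Equiv.refl X.ext, contMDiff_id, contMDiff_id⟩
      symm := by
        rintro X Y ⟨φ, h, h'⟩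
        exact ⟨φ.symm, h', h⟩
      trans := by
        rintro X Y Z ⟨φ, h, h'⟩ ⟨ψ, k, k'⟩
        exact ⟨φ.trans ψ, k.comp h, h'.comp k'⟩ }

/-- The collection of equivalence classes of extensions. -/
abbrev ExtClass : Type _ := Quotient (LieExtension.setoid I J G A)

variable {I J G A} in
/-- The equivalence class of an extension. -/
def LieExtension.toClass (X : LieExtension I J G A) : ExtClass I J G A :=
  Quotient.mk (LieExtension.setoid I J G A) X

end Extensions

end LocallySmooth

open Filter MeasureTheory

namespace LocallySmooth

/-! A cross section σ of an extension gives the cocycle F measuring its failure to be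
multiplicative. Two cross sections of one extension, or of two equivalent ones, differ by a cochain
c, and their cocycles differ by `d1 c`. Conversely, if two extensions have cross sections with the
same cocycle, then ι(a)σ(g) ↦ ι'(a)σ'(g) is an isomorphism; it is smooth near the identity, hence
everywhere by translation. In both arguments an A-valued function is known only through its image in
E. It inherits measurability because ι is a closed embedding, and smoothness because an injective
smooth homomorphism of Lie groups is an immersion (`injective_mfderiv_zero_of_injective`,
`contMDiffAt_of_comp_injective`).

For surjectivity, a cocycle normalized by F(1,1) = 0 turns A × G into a group with canonical section
σ. Its charts are the patches (α, v) ↦ α σ(g) σ(v) with v in a small neighbourhood U of 1. The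
cocycle identity makes the transition maps smooth, since the values of F far from the identity
cancel. Multiplication is harder: commuting σ(v) past σ(y) produces c_y(v) = F(v, y) - F(y, y⁻¹vy),
where F is evaluated away from (1,1) and so is known only to be measurable.

This is settled by automatic smoothness (`contMDiffAt_one_of_measurable`): a measurable cochain c
whose coboundary is smooth near (1,1) is smooth at 1. It applies to c_y because `d1 c_y` involves
only values of F near (1,1). Continuity comes from a Steinhaus argument. Smoothness comes from
averaging c(tu) = c(t) + t • c(u) - `d1 c`(t,u) over u against a bump function: by invariance of
Haar measure one side is a smooth function of t, and the other is a smooth function of t and c(t)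
that the inverse function theorem solves for c(t). -/

/-! ### Injective smooth homomorphisms of Lie groups are immersions -/

/-- Stated for plain normed spaces so that it can be applied to tangent spaces, which unfold to the
model space. -/
theorem comp_smulRight_one_eq_zero {V W : Type*} [NormedAddCommGroup V] [NormedSpace ℝ V]
    [NormedAddCommGroup W] [NormedSpace ℝ W] (T : V →L[ℝ] W) (v : V) (h : T v = 0) :
    T.comp (ContinuousLinearMap.smulRight (1 : ℝ →L[ℝ] ℝ) v) = 0 := by
  ext; simp [h]

theorem eq_zero_of_smulRight_one_eq_zero {V : Type*} [NormedAddCommGroup V] [NormedSpace ℝ V]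
    {v : V} (h : ContinuousLinearMap.smulRight (1 : ℝ →L[ℝ] ℝ) v = 0) : v = 0 := by
  simpa using congrArg (fun T : ℝ →L[ℝ] V => T 1) h

/-- A curve in a manifold whose derivative vanishes near a point is locally constant there. -/
theorem eventually_eq_of_hasMFDerivAt_zero {EX HX X : Type*}
    [NormedAddCommGroup EX] [NormedSpace ℝ EX] [TopologicalSpace HX] {K : ModelWithCorners ℝ EX HX}
    [TopologicalSpace X] [ChartedSpace HX X] [IsManifold K 1 X] {γ : ℝ → X} {t₀ : ℝ}
    (h : ∀ᶠ t in 𝓝 t₀, HasMFDerivAt 𝓘(ℝ, ℝ) K γ t 0) : ∀ᶠ t in 𝓝 t₀, γ t = γ t₀ := by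
  have hc : ContinuousAt γ t₀ := h.self_of_nhds.continuousAt
  have hs : ∀ᶠ t in 𝓝 t₀, γ t ∈ (chartAt HX (γ t₀)).source :=
    hc ((chartAt HX (γ t₀)).open_source.mem_nhds (mem_chart_source HX _))
  have hd : ∀ᶠ t in 𝓝 t₀, HasFDerivAt (extChartAt K (γ t₀) ∘ γ) (0 : ℝ →L[ℝ] EX) t := by
    filter_upwards [h, hs] with t ht hst
    refine hasMFDerivAt_iff_hasFDerivAt.1 ?_
    have h1 : MDifferentiableAt K 𝓘(ℝ, EX) (extChartAt K (γ t₀)) (γ t) :=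
      mdifferentiableAt_extChartAt hst
    have h2 := h1.hasMFDerivAt.comp t ht
    rwa [ContinuousLinearMap.comp_zero] at h2
  obtain ⟨ε, hε, hball⟩ := Metric.eventually_nhds_iff_ball.1 (hd.and hs)
  filter_upwards [Metric.ball_mem_nhds t₀ hε] with t ht
  have hconst : (extChartAt K (γ t₀) ∘ γ) t = (extChartAt K (γ t₀) ∘ γ) t₀ :=
    Metric.isOpen_ball.is_const_of_fderiv_eq_zero (𝕜 := ℝ) (convex_ball t₀ ε).isPreconnected
      (fun s hs => (hball s hs).1.differentiableAt.differentiableWithinAt)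
      (fun s hs => (hball s hs).1.fderiv) ht (Metric.mem_ball_self hε)
  refine (extChartAt K (γ t₀)).injOn ?_ ?_ hconst
  · rw [extChartAt_source]; exact (hball t ht).2
  · exact mem_extChartAt_source _

/-- A smooth map between finite-dimensional spaces with injective derivative at a point has a
smooth left inverse near that point. -/
theorem exists_contDiffAt_leftInverse {V W : Type*} [NormedAddCommGroup V] [NormedSpace ℝ V]
    [FiniteDimensional ℝ V] [NormedAddCommGroup W] [NormedSpace ℝ W] [FiniteDimensional ℝ W]
    {f : V → W} {a : V} (hf : ContDiffAt ℝ ∞ f a) (hinj : Function.Injective (fderiv ℝ f a)) :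
    ∃ g : W → V, ContDiffAt ℝ ∞ g (f a) ∧ ∀ᶠ x in 𝓝 a, g (f x) = x := by
  have : CompleteSpace V := FiniteDimensional.complete ℝ V
  obtain ⟨L, hL⟩ := (fderiv ℝ f a).toLinearMap.exists_leftInverse_of_injective
    (LinearMap.ker_eq_bot.2 hinj)
  let L' : W →L[ℝ] V := LinearMap.toContinuousLinearMap L
  have hF : ContDiffAt ℝ ∞ (L' ∘ f) a := L'.contDiff.contDiffAt.comp a hf
  have hF' : HasFDerivAt (L' ∘ f) ((ContinuousLinearEquiv.refl ℝ V : V ≃L[ℝ] V) : V →L[ℝ] V) a := by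
    have h := L'.hasFDerivAt.comp a (hf.differentiableAt (by simp)).hasFDerivAt
    convert h using 1
    ext x
    exact (LinearMap.congr_fun hL x).symm
  refine ⟨hF.localInverse hF' (by simp) ∘ L', ?_, ?_⟩
  · exact (hF.to_localInverse hF' (by simp)).comp (f a) L'.contDiff.contDiffAt
  · exact (hF.hasStrictFDerivAt' hF' (by simp)).eventually_left_inverse

section Immersion

variable {EA HA A EX HX X : Type*}
  [NormedAddCommGroup EA] [NormedSpace ℝ EA] [FiniteDimensional ℝ EA] [TopologicalSpace HA]
  {J : ModelWithCorners ℝ EA HA} [J.Boundaryless]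
  [AddCommGroup A] [TopologicalSpace A] [ChartedSpace HA A] [LieAddGroup J ∞ A]
  [NormedAddCommGroup EX] [NormedSpace ℝ EX] [TopologicalSpace HX]
  {K : ModelWithCorners ℝ EX HX}
  [Group X] [TopologicalSpace X] [ChartedSpace HX X] [LieGroup K ∞ X]

/-- An injective smooth homomorphism of Lie groups is an immersion at the identity. -/
theorem injective_mfderiv_zero_of_injective {i : A → X} (hi : ContMDiff J K ∞ i)
    (hinj : Function.Injective i) (hadd : ∀ a b, i (a + b) = i a * i b) :
    Function.Injective (mfderiv J K i 0) := by
  have : CompleteSpace EA := FiniteDimensional.complete ℝ EA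
  have : LieAddGroup J (minSmoothness ℝ 3) A := by
    rw [minSmoothness_of_isRCLikeNormedField]
    exact LieAddGroup.of_le (n := ∞) (mod_cast le_top : ((3 : ℕ∞) : WithTop ℕ∞) ≤ ∞)
  have : IsManifold J 1 A := IsManifold.of_le (n := ∞) (by exact_mod_cast le_top)
  have : IsManifold K 1 X := IsManifold.of_le (n := ∞) (by exact_mod_cast le_top)
  -- A kernel vector v spans an invariant vector field. Equivariance of i makes its derivative kill
  -- the whole field, so i is constant along the integral curve through 0. Injectivity makes that
  -- curve constant, and its velocity v vanishes.
  rw [injective_iff_map_eq_zero]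
  intro v hv
  have hX : ContMDiff J J.tangent 1
      (fun g => (⟨g, addInvariantVectorField v g⟩ : TangentBundle J A)) :=
    (contMDiff_addInvariantVectorField v).of_le
      (by rw [minSmoothness_of_isRCLikeNormedField]; exact_mod_cast one_le_two)
  obtain ⟨γ, hγ0, hγ⟩ := exists_isMIntegralCurveAt_of_contMDiffAt_boundaryless 0
    (hX.contMDiffAt (x := 0))
  have hdi : ∀ g, MDifferentiableAt J K i g := fun g =>
    (hi.contMDiffAt (x := g)).mdifferentiableAt (by simp)
  have hker : ∀ g, mfderiv J K i g (addInvariantVectorField v g) = 0 := by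
    intro g
    have hl : MDifferentiableAt J J (fun x => g + x) 0 :=
      ((contMDiff_add_left (I := J) (n := ∞) (a := g)).contMDiffAt).mdifferentiableAt (by simp)
    have hr : MDifferentiableAt K K (fun x => i g * x) (i 0) :=
      ((contMDiff_mul_left (I := K) (n := ∞) (a := i g)).contMDiffAt).mdifferentiableAt (by simp)
    have h1 := mfderiv_comp (I := J) (I' := J) (I'' := K) (0 : A) (hdi (g + 0)) hl
    have h2 := mfderiv_comp (I := J) (I' := K) (I'' := K) (0 : A) hr (hdi 0)
    have h3 : i ∘ (fun x => g + x) = (fun x => i g * x) ∘ i := funext fun x => hadd g x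
    rw [h3, h2] at h1
    have h4 := congrArg (fun T => T v) h1
    simp only [ContinuousLinearMap.comp_apply] at h4
    have h5 : mfderiv J K i 0 v = 0 := hv
    rw [h5, map_zero] at h4
    have h6 := h4.symm
    rw [addInvariantVectorField]
    -- The chain rule yields the derivative at g + 0, which equals g only propositionally;
    -- generalizing the base point allows the substitution.
    have h7 : ∀ g' : A, g' = g → mfderiv J K i g' ((mfderiv J J (fun x => g + x) 0) v) = 0 →
      mfderiv J K i g ((mfderiv J J (fun x => g + x) 0) v) = 0 := by
      rintro g' rfl h; exact h
    exact h7 _ (add_zero g) h6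
  have hconst : ∀ᶠ t in 𝓝 (0 : ℝ), (i ∘ γ) t = (i ∘ γ) 0 := by
    apply eventually_eq_of_hasMFDerivAt_zero (K := K)
    filter_upwards [hγ] with t ht
    have := ((hdi (γ t)).hasMFDerivAt).comp t ht
    refine this.congr_mfderiv ?_
    exact comp_smulRight_one_eq_zero (V := EA) (W := EX) (mfderiv J K i (γ t)) _ (hker (γ t))
  have hγc : γ =ᶠ[𝓝 0] fun _ => (0 : A) := by
    filter_upwards [hconst] with t ht
    rw [← hγ0]; exact hinj ht
  have hd := hγ.self_of_nhds
  have hd' : HasMFDerivAt 𝓘(ℝ, ℝ) J γ 0 0 :=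
    (hasMFDerivAt_const (0 : A) (0 : ℝ)).congr_of_eventuallyEq hγc
  have huniq := hasMFDerivAt_unique hd hd'
  have h8 : addInvariantVectorField v (γ 0) = 0 :=
    eq_zero_of_smulRight_one_eq_zero (V := EA) huniq
  rw [hγ0] at h8
  rw [addInvariantVectorField] at h8
  have h9 : (fun x : A => 0 + x) = id := funext zero_add
  rw [h9, mfderiv_id] at h8
  exact h8

/-- A continuous map into a Lie group `A` is smooth at a point if it becomes smooth after composition
with an injective smooth homomorphism of Lie groups. -/
theorem contMDiffAt_of_comp_injective [FiniteDimensional ℝ EX] {EM HM M : Type*}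
    [NormedAddCommGroup EM] [NormedSpace ℝ EM] [TopologicalSpace HM] {I : ModelWithCorners ℝ EM HM} [TopologicalSpace M] [ChartedSpace HM M]
    {i : A → X} (hi : ContMDiff J K ∞ i)
    (hinj : Function.Injective i) (hadd : ∀ a b, i (a + b) = i a * i b)
    {f : M → X} {h : M → A} {x : M} (hf : ContMDiffAt I K ∞ f x) (hh : ContinuousAt h x)
    (hfh : ∀ᶠ y in 𝓝 x, i (h y) = f y) : ContMDiffAt I J ∞ h x := by
  have hi0 : i 0 = 1 := by simpa using hadd 0 0
  -- Translating by -h x moves the value to 0, where i is known to be an immersion.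
  wlog h0 : h x = 0 generalizing f h
  · have hA : IsTopologicalAddGroup A := topologicalAddGroup_of_lieAddGroup J ∞
    have key := this (f := fun y => i (-h x) * f y) (h := fun y => -h x + h y)
      (contMDiffAt_const.mul hf) (continuousAt_const.add hh)
      (hfh.mono fun y hy => by rw [hadd, hy]) (by simp)
    have := (contMDiffAt_const (c := h x)).add key
    refine this.congr_of_eventuallyEq (Eventually.of_forall fun y => ?_)
    simp
  have : IsManifold J ∞ A := inferInstance
  let φ := extChartAt J (0 : A)
  let κ := extChartAt K (i 0)
  have hφt : φ.target ∈ 𝓝 (φ 0) := extChartAt_target_mem_nhds (I := J) 0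
  have hw : ContDiffAt ℝ ∞ (κ ∘ i ∘ φ.symm) (φ 0) := by
    have := (contMDiffAt_iff.1 (hi.contMDiffAt (x := 0))).2
    rwa [J.range_eq_univ, contDiffWithinAt_univ] at this
  have hinjw : Function.Injective (fderiv ℝ (κ ∘ i ∘ φ.symm) (φ 0)) := by
    have h1 := injective_mfderiv_zero_of_injective hi hinj hadd
    have h2 : mfderiv J K i 0 = fderivWithin ℝ (κ ∘ i ∘ φ.symm) (Set.range J) (φ 0) :=
      ((hi.contMDiffAt (x := 0)).mdifferentiableAt (by simp)).mfderiv
    rw [← fderivWithin_univ, ← J.range_eq_univ]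
    exact h2 ▸ h1
  -- Near x this gives h = φ.symm ∘ g ∘ κ ∘ f. Continuity of h at x keeps h y in the region where g
  -- inverts the chart expression of i.
  obtain ⟨g, hg, hgw⟩ := exists_contDiffAt_leftInverse hw hinjw
  have hfx : f x = i 0 := by rw [← hfh.self_of_nhds, h0]
  have hφh : Tendsto (fun y => φ (h y)) (𝓝 x) (𝓝 (φ 0)) := by
    have h1 : ContinuousAt φ (h x) := by rw [h0]; exact continuousAt_extChartAt 0
    have := h1.tendsto.comp hh.tendsto
    rwa [h0] at this
  have hsrc : ∀ᶠ y in 𝓝 x, h y ∈ φ.source :=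
    hh (by rw [h0]; exact extChartAt_source_mem_nhds (I := J) 0)
  have hκ : ContMDiffAt K 𝓘(ℝ, EX) ∞ κ (f x) := by rw [hfx]; exact contMDiffAt_extChartAt
  have hw0 : (κ ∘ i ∘ φ.symm) (φ 0) = κ (f x) := by
    rw [hfx]; simp only [Function.comp_apply, φ]; rw [extChartAt_to_inv]
  have hs : ContMDiffAt 𝓘(ℝ, EA) J ∞ φ.symm (φ 0) :=
    (contMDiffOn_extChartAt_symm (0 : A)).contMDiffAt hφt
  have hg0 : g (κ (f x)) = φ 0 := by rw [← hw0]; exact hgw.self_of_nhds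
  have hcomp : ContMDiffAt I J ∞ (fun y => φ.symm (g (κ (f y)))) x := by
    have h1 : ContMDiffAt 𝓘(ℝ, EX) 𝓘(ℝ, EA) ∞ g (κ (f x)) := by rw [← hw0]; exact hg.contMDiffAt
    have h2 : ContMDiffAt I 𝓘(ℝ, EA) ∞ (fun y => g (κ (f y))) x :=
      ContMDiffAt.comp x h1 (ContMDiffAt.comp x hκ hf)
    refine ContMDiffAt.comp x (I' := 𝓘(ℝ, EA)) (g := φ.symm) ?_ h2
    rw [hg0]; exact hs
  refine hcomp.congr_of_eventuallyEq ?_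
  filter_upwards [hφh.eventually hgw, hsrc, hfh] with y hy hys hyf
  simp only [Function.comp_apply, φ.left_inv hys, hyf] at hy
  rw [hy, φ.left_inv hys]

end Immersion

/-! ### Automatic continuity of measurable cochains -/

section AutomaticContinuity

variable {G A : Type*} [Group G] [TopologicalSpace G] [IsTopologicalGroup G]
  [LocallyCompactSpace G] [SecondCountableTopology G] [MeasurableSpace G] [BorelSpace G]
  [AddCommGroup A] [TopologicalSpace A] [IsTopologicalAddGroup A] [SecondCountableTopology A]
  [MeasurableSpace A] [BorelSpace A] [DistribMulAction G A] [ContinuousSMul G A]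

/-- A measurable cochain whose coboundary is continuous at the identity is continuous at the
identity. -/
theorem continuousAt_one_of_measurable {c : G → A} (hc : Measurable c)
    (hf : ContinuousAt (d1 G A c) (1, 1)) : ContinuousAt c 1 := by
  have h11 : d1 G A c (1, 1) = c 1 := by simp [d1]
  intro N hN
  -- If t = s₁ / s₂, the coboundary formula expresses c t through c s₁, t • c s₂ and d1 c (t, s₂).
  -- Inserting a base value b, it becomes this function at t, c s₁ - b, c s₂ - b, b - t • b and d1 c
  -- (t, s₂) - c 1, all of which can be made close to the base point.
  have hΦ : ContinuousAt (fun q : G × A × A × A × A =>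
      c 1 + (q.2.1 - q.1 • q.2.2.1 + q.2.2.2.1 + q.2.2.2.2)) (1, 0, 0, 0, 0) := by fun_prop
  have hN' := hΦ (by simpa using hN)
  obtain ⟨T, hT, W', hW', hTW⟩ := mem_nhds_prod_iff.1 hN'
  obtain ⟨W₁, hW₁, W'', hW'', h1⟩ := mem_nhds_prod_iff.1 hW'
  obtain ⟨W₂, hW₂, W''', hW''', h2⟩ := mem_nhds_prod_iff.1 hW''
  obtain ⟨W₃, hW₃, W₄, hW₄, h3⟩ := mem_nhds_prod_iff.1 hW'''
  have key : ∀ t ∈ T, ∀ p ∈ W₁, ∀ q ∈ W₂, ∀ r ∈ W₃, ∀ e ∈ W₄,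
      c 1 + (p - t • q + r + e) ∈ N := fun t ht p hp q hq r hr e he =>
    hTW (show (t, p, q, r, e) ∈ T ×ˢ W' from
      ⟨ht, h1 ⟨hp, h2 ⟨hq, h3 ⟨hr, he⟩⟩⟩⟩)
  obtain ⟨W, hWsub, hWo, h0W⟩ := mem_nhds_iff.1 (inter_mem hW₁ hW₂)
  have hd : Tendsto (fun p : G × G => d1 G A c p - c 1) (𝓝 (1, 1)) (𝓝 0) := by
    have h : Tendsto (fun p : G × G => d1 G A c p - c 1) (𝓝 (1, 1)) (𝓝 (d1 G A c (1, 1) - c 1)) :=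
      (hf.sub (continuousAt_const (y := c 1))).tendsto
    rwa [h11, sub_self] at h
  obtain ⟨V₁, hV₁, V₂, hV₂, hV⟩ := mem_nhds_prod_iff.1 (hd hW₄)
  obtain ⟨V, hVsub, hVo, h1V⟩ := mem_nhds_iff.1 (inter_mem hV₁ hV₂)
  obtain ⟨B, hBc, hBd⟩ := TopologicalSpace.exists_countable_dense A
  let μ : Measure G := Measure.haar
  let S : A → Set G := fun b => V ∩ c ⁻¹' ((fun a => a - b) ⁻¹' W)
  have hcover : V ⊆ ⋃ b ∈ B, S b := by
    intro v hv
    have hopen : IsOpen {b : A | c v - b ∈ W} := hWo.preimage (by fun_prop)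
    obtain ⟨b, hb, hbB⟩ := hBd.inter_open_nonempty _ hopen ⟨c v, by simpa using h0W⟩
    exact Set.mem_iUnion₂.2 ⟨b, hbB, hv, hb⟩
  -- Countably many sets S b cover the nonempty open set V, so one has positive Haar measure; by
  -- Steinhaus its set of quotients is a neighbourhood of 1.
  obtain ⟨b, -, hb⟩ : ∃ b ∈ B, μ (S b) ≠ 0 := by
    by_contra! hcon
    have h0 : μ V = 0 := measure_mono_null hcover ((measure_biUnion_null_iff hBc).2 hcon)
    exact (hVo.measure_pos μ ⟨1, h1V⟩).ne' h0
  have hSm : MeasurableSet (S b) := by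
    have : IsOpen ((fun a => a - b) ⁻¹' W) := hWo.preimage (by fun_prop)
    exact hVo.measurableSet.inter (hc this.measurableSet)
  have hdiv := Measure.div_mem_nhds_one_of_haar_pos μ (S b) hSm (pos_iff_ne_zero.2 hb)
  -- The value b need not be small, but it is fixed before t, so b - t • b is small for t near 1.
  have hbt : ∀ᶠ t : G in 𝓝 1, b - t • b ∈ W₃ := by
    have : ContinuousAt (fun t : G => b - t • b) 1 := by fun_prop
    exact this (by simpa using hW₃)
  change ∀ᶠ t in 𝓝 1, c t ∈ N
  filter_upwards [hdiv, hT, hV₁, hbt] with t ht htT htV htb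
  obtain ⟨s₁, hs₁, s₂, hs₂, rfl⟩ := Set.mem_div.1 ht
  have hval : c (s₁ / s₂) = c 1 + ((c s₁ - b) - (s₁ / s₂) • (c s₂ - b) + (b - (s₁ / s₂) • b)
      + (d1 G A c (s₁ / s₂, s₂) - c 1)) := by
    have : d1 G A c (s₁ / s₂, s₂) = (s₁ / s₂) • c s₂ - c s₁ + c (s₁ / s₂) := by simp [d1]
    rw [this, smul_sub]; abel
  rw [hval]
  exact key _ htT _ (hWsub hs₁.2).1 _ (hWsub hs₂.2).2 _ htb _ (hV ⟨htV, (hVsub hs₂.1).2⟩)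

end AutomaticContinuity

/-! ### Smooth dependence of integrals on a parameter -/

section ParametricIntegral

variable {P Z F Y : Type*} [NormedAddCommGroup P] [NormedSpace ℝ P]
  [NormedAddCommGroup Z] [NormedSpace ℝ Z] [FiniteDimensional ℝ Z] [MeasurableSpace Z]
  [BorelSpace Z] [NormedAddCommGroup F] [NormedSpace ℝ F] [FiniteDimensional ℝ F]
  [MeasurableSpace Y]

/-- Smoothness of an integral depending on a parameter, for an integrand which is smooth on a
product of balls and a finite measure carried by the smaller ball. -/
theorem contDiffOn_integral_of_ball {Q : P × Z → F} {p₀ : P} {z₀ : Z} {r : ℝ} (hr : 0 < r)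
    (hQ : ContDiffOn ℝ ∞ Q (Metric.ball p₀ r ×ˢ Metric.ball z₀ r)) {m : Measure Y}
    [IsFiniteMeasure m] {q : Y → Z} (hq : AEMeasurable q m)
    (hqm : ∀ᵐ y ∂m, q y ∈ Metric.ball z₀ (r / 2)) :
    ContDiffOn ℝ ∞ (fun p => ∫ y, Q (p, q y) ∂m) (Metric.ball p₀ r) ∧
      ∀ p ∈ Metric.ball p₀ r, Integrable (fun y => Q (p, q y)) m := by
  -- The cutoff is 1 on the half ball, which carries the measure, and 0 beyond 3r/4, so χ • Q is
  -- smooth for all z without changing the integral.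
  let χ : ContDiffBump z₀ := ⟨r / 2, 3 * r / 4, by positivity, by linarith⟩
  have hproper : ProperSpace Z := FiniteDimensional.proper ℝ Z
  have hFc : CompleteSpace F := FiniteDimensional.complete ℝ F
  have hχ1 : ∀ z ∈ Metric.ball z₀ (r / 2), χ z = 1 := fun z hz =>
    χ.one_of_mem_closedBall (Metric.ball_subset_closedBall hz)
  have hχ0 : ∀ z, z ∉ Metric.ball z₀ (3 * r / 4) → χ z = 0 := fun z hz => by
    apply χ.zero_of_le_dist
    simpa [χ] using hz
  let R : P × Z → F := fun w => χ w.2 • Q w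
  have hopen : IsOpen (Metric.ball p₀ r ×ˢ Metric.ball z₀ r) :=
    Metric.isOpen_ball.prod Metric.isOpen_ball
  have hR : ContDiffOn ℝ ∞ R (Metric.ball p₀ r ×ˢ Set.univ) := by
    rintro ⟨p, z⟩ ⟨hp, -⟩
    apply ContDiffAt.contDiffWithinAt
    by_cases hz : z ∈ Metric.ball z₀ r
    · have h1 : ContDiffAt ℝ ∞ (fun w : P × Z => χ w.2) (p, z) :=
        χ.contDiff.contDiffAt.comp (p, z) contDiffAt_snd
      exact h1.smul (hQ.contDiffAt (hopen.mem_nhds ⟨hp, hz⟩))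
    · have hz' : ∀ᶠ w : P × Z in 𝓝 (p, z), w.2 ∉ Metric.closedBall z₀ (3 * r / 4) := by
        refine continuousAt_snd.eventually (Metric.isClosed_closedBall.isOpen_compl.mem_nhds ?_)
        simp only [Metric.mem_ball, not_lt, Set.mem_compl_iff, Metric.mem_closedBall, not_le] at hz ⊢
        linarith
      refine (contDiffAt_const (c := (0 : F))).congr_of_eventuallyEq ?_
      filter_upwards [hz'] with w hw
      simp [R, hχ0 w.2 fun h => hw (Metric.ball_subset_closedBall h)]
  have hRQ : ∀ p, (fun y => R (p, q y)) =ᵐ[m] fun y => Q (p, q y) := fun p => by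
    filter_upwards [hqm] with y hy
    simp [R, hχ1 _ hy]
  have hRc : ∀ p ∈ Metric.ball p₀ r, Continuous fun z => R (p, z) := fun p hp =>
    continuousOn_univ.1 (hR.continuousOn.comp (by fun_prop) fun z _ => ⟨hp, trivial⟩)
  have hRs : ∀ p z, z ∉ Metric.closedBall z₀ (3 * r / 4) → R (p, z) = 0 := fun p z hz => by
    simp [R, hχ0 z fun h => hz (Metric.ball_subset_closedBall h)]
  let ν : Measure Z := m.map q
  have hint : ∀ p ∈ Metric.ball p₀ r, ∫ z, R (p, z) ∂ν = ∫ y, Q (p, q y) ∂m := fun p hp => by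
    rw [integral_map hq (hRc p hp).aestronglyMeasurable]
    exact integral_congr_ae (hRQ p)
  constructor
  -- The integral is the convolution at 0 of the constant 1 with z ↦ R (p, -z), with respect to the
  -- image measure; the two reflections cancel.
  · have hconv := contDiffOn_convolution_right_with_param (μ := ν) (n := ⊤)
      (ContinuousLinearMap.lsmul ℝ ℝ : ℝ →L[ℝ] F →L[ℝ] F) (f := fun _ : Z => (1 : ℝ))
      (g := fun p z => R (p, -z)) (s := Metric.ball p₀ r)
      (k := -Metric.closedBall z₀ (3 * r / 4)) Metric.isOpen_ball
      (isCompact_closedBall _ _).neg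
      (fun p z _ hz => hRs p _ fun h => hz (Set.mem_neg.2 h)) (locallyIntegrable_const 1)
      (hR.comp (t := Metric.ball p₀ r ×ˢ Set.univ)
        (f := fun w : P × Z => (w.1, -w.2)) (by fun_prop) fun w hw => hw)
    have h2 := hconv.comp (t := Metric.ball p₀ r ×ˢ Set.univ) (s := Metric.ball p₀ r)
      (f := fun p => (p, (0 : Z))) (by fun_prop) fun p hp => ⟨hp, trivial⟩
    refine h2.congr fun p hp => ?_
    simp only [Function.comp_apply, convolution, ContinuousLinearMap.lsmul_apply, one_smul,
      zero_sub, neg_neg]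
    exact (hint p hp).symm
  · intro p hp
    have h1 : Integrable (fun z => R (p, z)) ν :=
      (hRc p hp).integrable_of_hasCompactSupport
        (HasCompactSupport.intro (isCompact_closedBall z₀ (3 * r / 4)) fun z hz => hRs p z hz)
    exact ((integrable_map_measure (hRc p hp).aestronglyMeasurable hq).1 h1).congr (hRQ p)

end ParametricIntegral

/-- A function is locally smooth measurable at `p` if and only if it is measurable, and smooth at
all points near `p`. -/
theorem isLSM_iff {EM HM M EN HN N : Type*}
    [NormedAddCommGroup EM] [NormedSpace ℝ EM] [TopologicalSpace HM] {I : ModelWithCorners ℝ EM HM}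
    [TopologicalSpace M] [ChartedSpace HM M] [MeasurableSpace M]
    [NormedAddCommGroup EN] [NormedSpace ℝ EN] [TopologicalSpace HN] {J : ModelWithCorners ℝ EN HN}
    [TopologicalSpace N] [ChartedSpace HN N] [MeasurableSpace N] {p : M} {f : M → N} :
    IsLSM I J p f ↔ Measurable f ∧ ∀ᶠ q in 𝓝 p, ContMDiffAt I J ∞ f q := by
  refine and_congr_right fun _ => ⟨?_, ?_⟩
  · rintro ⟨U, hU, hp, hf⟩
    filter_upwards [hU.mem_nhds hp] with q hq
    exact hf.contMDiffAt (hU.mem_nhds hq)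
  · intro h
    obtain ⟨U, hUs, hU, hp⟩ := eventually_nhds_iff.1 h
    exact ⟨U, hU, hp, fun q hq => (hUs q hq).contMDiffWithinAt⟩

/-! ### Automatic smoothness of measurable cochains -/

section AutomaticSmoothness

/-- If `k α - m • α` is Lipschitz with constant `m / 2`, then the derivative of `k` at the given
point does not vanish on nonzero vectors. -/
theorem eq_zero_of_hasFDerivAt_of_norm_sub_le {V : Type*} [NormedAddCommGroup V] [NormedSpace ℝ V]
    {k : V → V} {k' : V →L[ℝ] V} {a : V} {m : ℝ} (hm : 0 < m) (hk : HasFDerivAt k k' a)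
    (h : ∀ᶠ x in 𝓝 a, ‖k x - k a - m • (x - a)‖ ≤ m / 2 * ‖x - a‖) {v : V} (hv : k' v = 0) :
    v = 0 := by
  -- The estimate puts k' within m / 2 of m • id in operator norm, so k' v = 0 forces m ‖v‖ ≤ m / 2
  -- * ‖v‖.
  have h1 : HasFDerivAt (fun x => k x - m • x) (k' - m • ContinuousLinearMap.id ℝ V) a :=
    hk.sub ((hasFDerivAt_id a).const_smul m)
  have h2 : ‖k' - m • ContinuousLinearMap.id ℝ V‖ ≤ m / 2 := by
    refine h1.le_of_lip' (by positivity) ?_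
    filter_upwards [h] with x hx
    convert hx using 2
    rw [smul_sub]; abel
  have h3 := (k' - m • ContinuousLinearMap.id ℝ V).le_of_opNorm_le h2 v
  simp only [sub_apply, hv, smul_apply,
    ContinuousLinearMap.id_apply, zero_sub, norm_neg, norm_smul, Real.norm_eq_abs,
    abs_of_pos hm] at h3
  have h4 : ‖v‖ ≤ 0 := by nlinarith [norm_nonneg v]
  exact norm_le_zero_iff.1 h4

/-- Near a point where `Q (x₀, ·, z₀)` is the identity, `Q` is close to the identity in its middle
variable. -/
theorem eventually_norm_sub_le_half {V W Z : Type*} [NormedAddCommGroup V] [NormedSpace ℝ V]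
    [NormedAddCommGroup W] [NormedSpace ℝ W] [NormedAddCommGroup Z] [NormedSpace ℝ Z]
    {Q : (W × V) × Z → V} {x₀ : W} {a₀ : V} {z₀ : Z} (hQ : ContDiffAt ℝ ∞ Q ((x₀, a₀), z₀))
    (hid : ∀ᶠ a in 𝓝 a₀, Q ((x₀, a), z₀) = a) :
    ∀ᶠ p in 𝓝 (a₀, z₀), ‖Q ((x₀, p.1), p.2) - Q ((x₀, a₀), p.2) - (p.1 - a₀)‖
      ≤ 1 / 2 * ‖p.1 - a₀‖ := by
  -- Strict differentiability compares two nearby points with the same z, which makes the estimate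
  -- uniform in z; the partial derivative in the middle variable is the identity.
  have hs := hQ.hasStrictFDerivAt (by simp)
  set D := fderiv ℝ Q ((x₀, a₀), z₀)
  have hD : ∀ v, D ((0, v), 0) = v := by
    intro v
    let L : V →L[ℝ] (W × V) × Z := ((0 : V →L[ℝ] W).prod (ContinuousLinearMap.id ℝ V)).prod 0
    have hj : HasFDerivAt (fun a : V => ((x₀, a), z₀)) L a₀ :=
      ((hasFDerivAt_const x₀ a₀).prodMk (hasFDerivAt_id a₀)).prodMk (hasFDerivAt_const z₀ a₀)
    have h1 := HasFDerivAt.comp (f := fun a : V => ((x₀, a), z₀)) a₀ hs.hasFDerivAt hj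
    have h2 : HasFDerivAt (Q ∘ fun a : V => ((x₀, a), z₀)) (ContinuousLinearMap.id ℝ V) a₀ :=
      (hasFDerivAt_id a₀).congr_of_eventuallyEq hid
    exact congrArg (fun T : V →L[ℝ] V => T v) (h1.unique h2)
  have hb := hs.isLittleO.bound (by norm_num : (0 : ℝ) < 1 / 2)
  have ht : Tendsto (fun p : V × Z => (((x₀, p.1), p.2), ((x₀, a₀), p.2))) (𝓝 (a₀, z₀))
      (𝓝 (((x₀, a₀), z₀), ((x₀, a₀), z₀))) := by
    refine Continuous.tendsto' ?_ _ _ rfl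
    fun_prop
  filter_upwards [ht.eventually hb] with p hp
  have h3 : (((x₀, p.1), p.2) : (W × V) × Z) - ((x₀, a₀), p.2) = ((0, p.1 - a₀), 0) := by simp
  rw [h3, hD] at hp
  simpa using hp

variable {EG HG G EA HA A : Type*}
  [NormedAddCommGroup EG] [NormedSpace ℝ EG] [TopologicalSpace HG]
  {I : ModelWithCorners ℝ EG HG} [I.Boundaryless]
  [Group G] [TopologicalSpace G] [ChartedSpace HG G] [LieGroup I ∞ G]
  [NormedAddCommGroup EA] [NormedSpace ℝ EA] [TopologicalSpace HA]
  {J : ModelWithCorners ℝ EA HA} [J.Boundaryless]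
  [AddCommGroup A] [TopologicalSpace A] [ChartedSpace HA A] [LieAddGroup J ∞ A]
  [DistribMulAction G A] [ContMDiffSMul I J ∞ G A]

/-- The identity `c (t u) = c t + t • c u - d1 c (t, u)` in the charts. -/
noncomputable def translationInCharts (I : ModelWithCorners ℝ EG HG) (J : ModelWithCorners ℝ EA HA)
    (a : A) (f : G × G → A) (w : (EG × EA) × (EG × EA)) : EA :=
  extChartAt J a ((extChartAt J a).symm w.1.2
    + (extChartAt I (1 : G)).symm w.1.1 • (extChartAt J a).symm w.2.2
    - f ((extChartAt I (1 : G)).symm w.1.1, (extChartAt I (1 : G)).symm w.2.1))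

/-- At the base point the argument of the outer chart is a + a - f (1, 1) = a, so by continuity it
stays in the chart domain nearby. -/
theorem eventually_contDiffAt_translationInCharts {a : A} {f : G × G → A} (h1 : f (1, 1) = a)
    (hf : ∀ᶠ p in 𝓝 ((1, 1) : G × G), ContMDiffAt (I.prod I) J ∞ f p) :
    ∀ᶠ w in 𝓝 ((extChartAt I (1 : G) 1, extChartAt J a a), (extChartAt I (1 : G) 1, extChartAt J a a)),
      ContDiffAt ℝ ∞ (translationInCharts I J a f) w := by
  have hAt : IsTopologicalAddGroup A := topologicalAddGroup_of_lieAddGroup J ∞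
  set φ := extChartAt I (1 : G) with hφ
  set κ := extChartAt J a with hκ
  have hφt : φ.target ∈ 𝓝 (φ 1) := extChartAt_target_mem_nhds (I := I) 1
  have hκt : κ.target ∈ 𝓝 (κ a) := extChartAt_target_mem_nhds (I := J) a
  have hφs : ∀ x ∈ φ.target, ContMDiffAt 𝓘(ℝ, EG) I ∞ φ.symm x := fun x hx =>
    (contMDiffOn_extChartAt_symm (1 : G)).contMDiffAt ((isOpen_extChartAt_target 1).mem_nhds hx)
  have hκs : ∀ x ∈ κ.target, ContMDiffAt 𝓘(ℝ, EA) J ∞ κ.symm x := fun x hx =>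
    (contMDiffOn_extChartAt_symm a).contMDiffAt ((isOpen_extChartAt_target a).mem_nhds hx)
  let w₀ : (EG × EA) × (EG × EA) := ((φ 1, κ a), (φ 1, κ a))
  have e1 : ∀ᶠ w : (EG × EA) × (EG × EA) in 𝓝 w₀, w.1.1 ∈ φ.target :=
    (Continuous.tendsto' (by fun_prop) w₀ (φ 1) rfl).eventually hφt
  have e2 : ∀ᶠ w : (EG × EA) × (EG × EA) in 𝓝 w₀, w.1.2 ∈ κ.target :=
    (Continuous.tendsto' (by fun_prop) w₀ (κ a) rfl).eventually hκt
  have e3 : ∀ᶠ w : (EG × EA) × (EG × EA) in 𝓝 w₀, w.2.1 ∈ φ.target :=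
    (Continuous.tendsto' (by fun_prop) w₀ (φ 1) rfl).eventually hφt
  have e4 : ∀ᶠ w : (EG × EA) × (EG × EA) in 𝓝 w₀, w.2.2 ∈ κ.target :=
    (Continuous.tendsto' (by fun_prop) w₀ (κ a) rfl).eventually hκt
  let s : (EG × EA) × (EG × EA) → A := fun w =>
    κ.symm w.1.2 + φ.symm w.1.1 • κ.symm w.2.2 - f (φ.symm w.1.1, φ.symm w.2.1)
  let E := (EG × EA) × (EG × EA)
  have hs : ∀ w : E, w.1.1 ∈ φ.target → w.1.2 ∈ κ.target → w.2.1 ∈ φ.target → w.2.2 ∈ κ.target →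
      ContMDiffAt (I.prod I) J ∞ f (φ.symm w.1.1, φ.symm w.2.1) →
      ContMDiffAt 𝓘(ℝ, E) J ∞ s w := by
    intro w h1 h2 h3 h4 h5
    have a1 : ContMDiffAt 𝓘(ℝ, E) I ∞ (fun w : E => φ.symm w.1.1) w :=
      ContMDiffAt.comp w (hφs _ h1)
        (contMDiffAt_iff_contDiffAt.2 (contDiff_fst.fst).contDiffAt)
    have a2 : ContMDiffAt 𝓘(ℝ, E) J ∞ (fun w : E => κ.symm w.1.2) w :=
      ContMDiffAt.comp w (hκs _ h2)
        (contMDiffAt_iff_contDiffAt.2 (contDiff_fst.snd).contDiffAt)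
    have a3 : ContMDiffAt 𝓘(ℝ, E) I ∞ (fun w : E => φ.symm w.2.1) w :=
      ContMDiffAt.comp w (hφs _ h3)
        (contMDiffAt_iff_contDiffAt.2 (contDiff_snd.fst).contDiffAt)
    have a4 : ContMDiffAt 𝓘(ℝ, E) J ∞ (fun w : E => κ.symm w.2.2) w :=
      ContMDiffAt.comp w (hκs _ h4)
        (contMDiffAt_iff_contDiffAt.2 (contDiff_snd.snd).contDiffAt)
    exact (a2.add (a1.smul a4)).sub
      (ContMDiffAt.comp (f := fun w : E => (φ.symm w.1.1, φ.symm w.2.1)) w h5 (a1.prodMk a3))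
  have hs₀ : s w₀ = a := by
    simp only [s, w₀]
    rw [φ.left_inv (mem_extChartAt_source (1 : G)), κ.left_inv (mem_extChartAt_source a), h1]
    simp
  have hφc : ContinuousAt (fun w : E => (φ.symm w.1.1, φ.symm w.2.1)) w₀ :=
    (ContinuousAt.comp (f := fun w : E => w.1.1) (hφs _ (mem_of_mem_nhds hφt)).continuousAt
      (by fun_prop)).prodMk
    (ContinuousAt.comp (f := fun w : E => w.2.1) (hφs _ (mem_of_mem_nhds hφt)).continuousAt
      (by fun_prop))
  have e5 : ∀ᶠ w : E in 𝓝 w₀, ContMDiffAt (I.prod I) J ∞ f (φ.symm w.1.1, φ.symm w.2.1) := by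
    have : (φ.symm w₀.1.1, φ.symm w₀.2.1) = ((1, 1) : G × G) := by
      simp only [w₀]
      rw [φ.left_inv (mem_extChartAt_source (1 : G))]
    rw [ContinuousAt, this] at hφc
    exact hφc.eventually hf
  have hsc : ContinuousAt s w₀ := (hs w₀ e1.self_of_nhds e2.self_of_nhds e3.self_of_nhds
    e4.self_of_nhds e5.self_of_nhds).continuousAt
  have e6 : ∀ᶠ w : E in 𝓝 w₀, s w ∈ κ.source :=
    hsc (by rw [hs₀]; exact extChartAt_source_mem_nhds (I := J) a)
  filter_upwards [e1, e2, e3, e4, e5, e6] with w h1 h2 h3 h4 h5 h6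
  rw [← contMDiffAt_iff_contDiffAt]
  have : ContMDiffAt J 𝓘(ℝ, EA) ∞ κ (s w) := by
    apply contMDiffAt_extChartAt'
    rwa [← extChartAt_source J]
  exact ContMDiffAt.comp w this (hs w h1 h2 h3 h4 h5)

variable [FiniteDimensional ℝ EG] [T2Space G] [SecondCountableTopology G] [MeasurableSpace G]
  [BorelSpace G] [FiniteDimensional ℝ EA] [SecondCountableTopology A] [MeasurableSpace A]
  [BorelSpace A]

/-- A measurable cochain whose coboundary is smooth around the identity is smooth at the
identity. -/
theorem contMDiffAt_one_of_measurable {c : G → A} (hc : Measurable c)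
    (hf : ∀ᶠ p in 𝓝 ((1, 1) : G × G), ContMDiffAt (I.prod I) J ∞ (d1 G A c) p) :
    ContMDiffAt I J ∞ c 1 := by
  have hGt : IsTopologicalGroup G := topologicalGroup_of_lieGroup I ∞
  have hAt : IsTopologicalAddGroup A := topologicalAddGroup_of_lieAddGroup J ∞
  have hGl : LocallyCompactSpace G := Manifold.locallyCompact_of_finiteDimensional I
  have hsmul : ContinuousSMul G A :=
    ⟨(contMDiff_smul (I := I) (I' := J) (n := ∞) (G := G) (M := A)).continuous⟩
  have hcc : ContinuousAt c 1 := continuousAt_one_of_measurable hc hf.self_of_nhds.continuousAt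
  borelize EG
  borelize EA
  let μ : Measure G := Measure.haar
  set φ := extChartAt I (1 : G) with hφ
  set κ := extChartAt J (c 1) with hκ
  have hφt : φ.target ∈ 𝓝 (φ 1) := extChartAt_target_mem_nhds (I := I) 1
  have hφs : ∀ x ∈ φ.target, ContMDiffAt 𝓘(ℝ, EG) I ∞ φ.symm x := fun x hx =>
    (contMDiffOn_extChartAt_symm (1 : G)).contMDiffAt ((isOpen_extChartAt_target 1).mem_nhds hx)
  have h1s : (1 : G) ∈ φ.source := mem_extChartAt_source 1
  -- For t, u near 1, κ (c (t * u)) = Q ((φ t, κ (c t)), (φ u, κ (c u))). Integrated over u against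
  -- a bump function ψ this becomes Θ (φ t, κ (c t)) = Ψ (φ t). Both Θ and Ψ are smooth although c
  -- is only measurable, since c enters them only through the variable of integration. The equation
  -- is then solved for κ (c t).
  let Q := translationInCharts I J (c 1) (d1 G A c)
  let z₀ : EG × EA := (φ 1, κ (c 1))
  have h11 : d1 G A c (1, 1) = c 1 := by simp [d1]
  have hQ : ∀ᶠ w in 𝓝 (z₀, z₀), ContDiffAt ℝ ∞ Q w :=
    eventually_contDiffAt_translationInCharts h11 hf
  have hid : ∀ᶠ α in 𝓝 (κ (c 1)), Q ((φ 1, α), z₀) = α := by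
    filter_upwards [extChartAt_target_mem_nhds (I := J) (c 1)] with α hα
    simp only [Q, translationInCharts, z₀]
    rw [← hφ, ← hκ, φ.left_inv h1s, κ.left_inv (mem_extChartAt_source _), h11, one_smul,
      add_sub_cancel_right, κ.right_inv hα]
  have hhalf := eventually_norm_sub_le_half (hQ.self_of_nhds) hid
  obtain ⟨r, hr, hrQ, hrφ, hrhalf⟩ : ∃ r > 0,
      (∀ w ∈ Metric.ball z₀ r ×ˢ Metric.ball z₀ r, ContDiffAt ℝ ∞ Q w) ∧
      (∀ x ∈ Metric.ball (φ 1) r, x ∈ φ.target) ∧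
      (∀ α ∈ Metric.ball (κ (c 1)) r, ∀ z ∈ Metric.ball z₀ r,
        ‖Q ((φ 1, α), z) - Q ((φ 1, κ (c 1)), z) - (α - κ (c 1))‖ ≤ 1 / 2 * ‖α - κ (c 1)‖) := by
    obtain ⟨r₁, hr₁, H₁⟩ := Metric.eventually_nhds_iff_ball.1 hQ
    obtain ⟨r₂, hr₂, H₂⟩ := Metric.mem_nhds_iff.1 hφt
    obtain ⟨r₃, hr₃, H₃⟩ := Metric.eventually_nhds_iff_ball.1 hhalf
    refine ⟨min r₁ (min r₂ r₃), by positivity, fun w hw => H₁ w ?_, fun x hx => H₂ ?_,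
      fun α hα z hz => H₃ (α, z) ?_⟩
    · rw [ball_prod_same] at hw
      exact Metric.ball_subset_ball (min_le_left _ _) hw
    · exact Metric.ball_subset_ball ((min_le_right _ _).trans (min_le_left _ _)) hx
    · rw [← ball_prod_same]
      exact ⟨Metric.ball_subset_ball ((min_le_right _ _).trans (min_le_right _ _)) hα,
        Metric.ball_subset_ball ((min_le_right _ _).trans (min_le_right _ _)) hz⟩
  let q : G → EG × EA := fun u => (φ u, κ (c u))
  have hqc : ContinuousAt q 1 :=
    (continuousAt_extChartAt (I := I) 1).prodMk
      (ContinuousAt.comp (f := c) (continuousAt_extChartAt (I := J) (c 1)) hcc)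
  -- The continuity of c at 1, already established, is what confines its values on V to one chart.
  obtain ⟨V, hVo, h1V, hVφ, hVκ, hVq, hVμ⟩ : ∃ V : Set G, IsOpen V ∧ 1 ∈ V ∧ V ⊆ φ.source ∧
      (∀ u ∈ V, c u ∈ κ.source) ∧ (∀ u ∈ V, q u ∈ Metric.ball z₀ (r / 2)) ∧ μ V < ⊤ := by
    obtain ⟨V₀, h1V₀, hV₀o, hV₀μ⟩ := μ.exists_isOpen_measure_lt_top 1
    have ev : ∀ᶠ u in 𝓝 (1 : G), u ∈ V₀ ∧ u ∈ φ.source ∧ c u ∈ κ.source ∧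
        q u ∈ Metric.ball z₀ (r / 2) := by
      filter_upwards [hV₀o.mem_nhds h1V₀, extChartAt_source_mem_nhds (I := I) (1 : G),
        hcc (extChartAt_source_mem_nhds (I := J) (c 1)),
        hqc (Metric.ball_mem_nhds z₀ (half_pos hr))] with u h1 h2 h3 h4
      exact ⟨h1, h2, h3, h4⟩
    obtain ⟨V, hV, hVo, h1V⟩ := eventually_nhds_iff.1 ev
    exact ⟨V, hVo, h1V, fun u hu => (hV u hu).2.1, fun u hu => (hV u hu).2.2.1,
      fun u hu => (hV u hu).2.2.2, (measure_mono fun u hu => (hV u hu).1).trans_lt hV₀μ⟩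
  obtain ⟨V', hV'n, hV'mul⟩ : ∃ V' ∈ 𝓝 (1 : G), ∀ t ∈ V', ∀ u ∈ V', t * u ∈ V := by
    have : ContinuousAt (fun p : G × G => p.1 * p.2) (1, 1) := continuous_mul.continuousAt
    have hVn : V ∈ 𝓝 ((1 : G) * 1) := by rw [mul_one]; exact hVo.mem_nhds h1V
    obtain ⟨A₁, hA₁, A₂, hA₂, h⟩ := mem_nhds_prod_iff.1 (this hVn)
    exact ⟨A₁ ∩ A₂, inter_mem hA₁ hA₂, fun t ht u hu => h (show (t, u) ∈ _ from ⟨ht.1, hu.2⟩)⟩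
  have h1V' : (1 : G) ∈ V' := mem_of_mem_nhds hV'n
  -- Since V' * V' ⊆ V, both ψ and its translates by t ∈ V' vanish outside V, so integrals over V
  -- are integrals over G, where Haar measure is invariant.
  obtain ⟨ψ, -, hψV'⟩ := (SmoothBumpFunction.nhds_basis_support (I := I) hV'n).mem_iff.1 hV'n
  have hψ0 : ∀ u, u ∉ V' → ψ u = 0 := fun u hu => by
    by_contra h; exact hu (hψV' h)
  have hV'V : V' ⊆ V := fun u hu => by simpa using hV'mul 1 h1V' u hu
  have hψs : ContMDiff I 𝓘(ℝ, ℝ) ∞ ψ := ψ.contMDiff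
  have hfin : IsFiniteMeasure (μ.restrict V) := ⟨by simpa using hVμ⟩
  have hqm : AEMeasurable q (μ.restrict V) := by
    have h1 : AEMeasurable φ (μ.restrict V) :=
      ((continuousOn_extChartAt (I := I) (1 : G)).mono hVφ).aemeasurable hVo.measurableSet
    classical
    -- Outside its source the chart is an arbitrary function, so it is replaced there by 0 before
    -- measurability is invoked.
    have h2 : Measurable (κ.source.piecewise κ fun _ => (0 : EA)) :=
      (continuousOn_extChartAt (I := J) (c 1)).measurable_piecewise continuousOn_const
        (isOpen_extChartAt_source (I := J) (c 1)).measurableSet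
    have h3 : AEMeasurable (fun u => κ (c u)) (μ.restrict V) := by
      refine (h2.comp hc).aemeasurable.congr ?_
      filter_upwards [ae_restrict_mem hVo.measurableSet] with u hu
      simp [hVκ u hu]
    exact h1.prodMk h3
  have hqb : ∀ᵐ u ∂μ.restrict V, q u ∈ Metric.ball z₀ (r / 2) := by
    filter_upwards [ae_restrict_mem hVo.measurableSet] with u hu using hVq u hu
  have hVinv : ∀ u ∈ V, φ.symm (q u).1 = u := fun u hu => φ.left_inv (hVφ hu)
  have hfstt : ∀ z ∈ Metric.ball z₀ r, z.1 ∈ φ.target := fun z hz => by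
    rw [← ball_prod_same] at hz
    exact hrφ _ hz.1
  -- the translated average
  let Q₁ : EG × (EG × EA) → EA := fun w => ψ ((φ.symm w.1)⁻¹ * φ.symm w.2.1) • w.2.2
  have hQ₁ : ContDiffOn ℝ ∞ Q₁ (Metric.ball (φ 1) r ×ˢ Metric.ball z₀ r) := by
    rintro w ⟨hw1, hw2⟩
    apply ContDiffAt.contDiffWithinAt
    rw [← contMDiffAt_iff_contDiffAt]
    have a1 : ContMDiffAt 𝓘(ℝ, EG × (EG × EA)) I ∞ (fun w : EG × (EG × EA) => φ.symm w.1) w :=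
      ContMDiffAt.comp w (hφs _ (hrφ _ hw1)) (contMDiffAt_iff_contDiffAt.2 contDiffAt_fst)
    have a2 : ContMDiffAt 𝓘(ℝ, EG × (EG × EA)) I ∞ (fun w : EG × (EG × EA) => φ.symm w.2.1) w :=
      ContMDiffAt.comp w (hφs _ (hfstt _ hw2))
        (contMDiffAt_iff_contDiffAt.2 (contDiff_snd.fst).contDiffAt)
    exact (ContMDiffAt.comp w hψs.contMDiffAt (a1.inv.mul a2)).smul
      (contMDiffAt_iff_contDiffAt.2 (contDiff_snd.snd).contDiffAt)
  let Q₂ : (EG × EA) × (EG × EA) → EA := fun w => ψ (φ.symm w.2.1) • Q w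
  have hQ₂ : ContDiffOn ℝ ∞ Q₂ (Metric.ball z₀ r ×ˢ Metric.ball z₀ r) := by
    intro w hw
    apply ContDiffAt.contDiffWithinAt
    have a1 : ContMDiffAt 𝓘(ℝ, (EG × EA) × (EG × EA)) 𝓘(ℝ, ℝ) ∞
        (fun w : (EG × EA) × (EG × EA) => ψ (φ.symm w.2.1)) w :=
      ContMDiffAt.comp w hψs.contMDiffAt (ContMDiffAt.comp w (hφs _ (hfstt _ hw.2))
        (contMDiffAt_iff_contDiffAt.2 (contDiff_snd.fst).contDiffAt))
    exact (contMDiffAt_iff_contDiffAt.1 a1).smul (hrQ w hw)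
  obtain ⟨hΨ, -⟩ := contDiffOn_integral_of_ball hr hQ₁ hqm hqb
  obtain ⟨hΘ, hΘi⟩ := contDiffOn_integral_of_ball hr hQ₂ hqm hqb
  set Ψ : EG → EA := fun x => ∫ u in V, Q₁ (x, q u) ∂μ with hΨdef
  set Θ : EG × EA → EA := fun p => ∫ u in V, Q₂ (p, q u) ∂μ with hΘdef
  have hΘΨ : ∀ t ∈ V', Θ (q t) = Ψ (φ t) := by
    intro t ht
    have htV := hV'V ht
    have e1 : Θ (q t) = ∫ u in V, ψ u • κ (c (t * u)) ∂μ := by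
      refine setIntegral_congr_fun hVo.measurableSet fun u hu => ?_
      simp only [Q₂, hVinv u hu]
      simp only [Q, translationInCharts, q]
      rw [← hφ, ← hκ, φ.left_inv (hVφ htV), φ.left_inv (hVφ hu), κ.left_inv (hVκ t htV),
        κ.left_inv (hVκ u hu)]
      congr 2
      simp only [d1, AddMonoidHom.coe_mk, ZeroHom.coe_mk]
      abel
    have e2 : ∫ u in V, ψ u • κ (c (t * u)) ∂μ = ∫ u, ψ u • κ (c (t * u)) ∂μ :=
      setIntegral_eq_integral_of_forall_compl_eq_zero fun u hu => by
        rw [hψ0 u fun h => hu (hV'V h), zero_smul]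
    -- The substitution v = t * u moves t from the measurable c into the smooth ψ.
    have e3 : ∫ u, ψ u • κ (c (t * u)) ∂μ = ∫ v, ψ (t⁻¹ * v) • κ (c v) ∂μ := by
      rw [← integral_mul_left_eq_self (fun v => ψ (t⁻¹ * v) • κ (c v)) t]
      simp
    have e4 : ∫ v in V, ψ (t⁻¹ * v) • κ (c v) ∂μ = ∫ v, ψ (t⁻¹ * v) • κ (c v) ∂μ :=
      setIntegral_eq_integral_of_forall_compl_eq_zero fun v hv => by
        rw [hψ0 (t⁻¹ * v) fun h => hv (by simpa using hV'mul t ht _ h), zero_smul]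
    rw [e1, e2, e3, ← e4]
    refine setIntegral_congr_fun hVo.measurableSet fun v hv => ?_
    simp only [Q₁, hVinv v hv, φ.left_inv (hVφ htV), q]
  -- the mass of the bump function
  let m : ℝ := ∫ u in V, ψ u ∂μ
  have hψi : Integrable ψ μ := hψs.continuous.integrable_of_hasCompactSupport ψ.hasCompactSupport
  have hm : 0 < m := by
    have e1 : m = ∫ u, ψ u ∂μ := setIntegral_eq_integral_of_forall_compl_eq_zero fun u hu =>
      hψ0 u fun h => hu (hV'V h)
    rw [e1]
    exact hψs.continuous.integral_pos_of_hasCompactSupport_nonneg_nonzero ψ.hasCompactSupport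
      (fun u => ψ.nonneg) (x := 1) (by rw [ψ.eq_one]; norm_num)
  have hz₀ : z₀ ∈ Metric.ball z₀ r := Metric.mem_ball_self hr
  -- Each Q ((φ 1, ·), z) differs from the identity by at most half the displacement from κ (c 1),
  -- uniformly in z; averaging against ψ, of total mass m, gives m • id up to m / 2.
  have hlip : ∀ α ∈ Metric.ball (κ (c 1)) r, ‖Θ (φ 1, α) - Θ (φ 1, κ (c 1)) -
      m • (α - κ (c 1))‖ ≤ m / 2 * ‖α - κ (c 1)‖ := by
    intro α hα
    have i1 := hΘi (φ 1, α) (by rw [← ball_prod_same]; exact ⟨Metric.mem_ball_self hr, hα⟩)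
    have i2 := hΘi z₀ hz₀
    have i3 : Integrable (fun u => ψ u • (α - κ (c 1))) (μ.restrict V) :=
      hψi.integrableOn.smul_const _
    have e1 : Θ (φ 1, α) - Θ (φ 1, κ (c 1)) - m • (α - κ (c 1)) =
        ∫ u in V, (Q₂ ((φ 1, α), q u) - Q₂ (z₀, q u) - ψ u • (α - κ (c 1))) ∂μ := by
      have i12 : Integrable (fun u => Q₂ ((φ 1, α), q u) - Q₂ (z₀, q u)) (μ.restrict V) :=
        i1.sub i2
      rw [integral_sub i12 i3, integral_sub i1 i2, integral_smul_const]
    have e2 : m / 2 * ‖α - κ (c 1)‖ = ∫ u in V, ψ u * (1 / 2 * ‖α - κ (c 1)‖) ∂μ := by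
      rw [integral_mul_const]; ring
    rw [e1, e2]
    refine norm_integral_le_of_norm_le (hψi.integrableOn.mul_const _) ?_
    filter_upwards [ae_restrict_mem hVo.measurableSet] with u hu
    have hqu : q u ∈ Metric.ball z₀ r := Metric.ball_subset_ball (half_le_self hr.le) (hVq u hu)
    simp only [Q₂, hVinv u hu]
    rw [← smul_sub, ← smul_sub, norm_smul, Real.norm_eq_abs, abs_of_nonneg ψ.nonneg]
    exact mul_le_mul_of_nonneg_left (hrhalf α hα _ hqu) ψ.nonneg
  -- the inverse function theorem
  let T : EG × EA → EG × EA := fun p => (p.1, Θ p)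
  have hΘ₀ : ContDiffAt ℝ ∞ Θ z₀ := hΘ.contDiffAt (Metric.ball_mem_nhds _ hr)
  have hT : ContDiffAt ℝ ∞ T z₀ := contDiffAt_fst.prodMk hΘ₀
  have hTd : HasFDerivAt T ((ContinuousLinearMap.fst ℝ EG EA).prod (fderiv ℝ Θ z₀)) z₀ :=
    hasFDerivAt_fst.prodMk (hΘ₀.differentiableAt (by simp)).hasFDerivAt
  have hTinj : Function.Injective (fderiv ℝ T z₀) := by
    rw [hTd.fderiv, injective_iff_map_eq_zero]
    rintro ⟨ξ, η⟩ hξη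
    simp only [ContinuousLinearMap.prod_apply, ContinuousLinearMap.coe_fst', Prod.mk_eq_zero] at hξη
    obtain ⟨rfl, hη⟩ := hξη
    have hk : HasFDerivAt (fun α : EA => Θ (φ 1, α))
        ((fderiv ℝ Θ z₀).comp ((0 : EA →L[ℝ] EG).prod (ContinuousLinearMap.id ℝ EA)))
        (κ (c 1)) :=
      HasFDerivAt.comp (f := fun α : EA => (φ 1, α)) (κ (c 1))
        (hΘ₀.differentiableAt (by simp)).hasFDerivAt
        ((hasFDerivAt_const (φ 1) (κ (c 1))).prodMk (hasFDerivAt_id (κ (c 1))))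
    have := eq_zero_of_hasFDerivAt_of_norm_sub_le hm hk
      (by filter_upwards [Metric.ball_mem_nhds (κ (c 1)) hr] with α hα using hlip α hα) (v := η) hη
    rw [this]; rfl
  obtain ⟨g, hg, hgT⟩ := exists_contDiffAt_leftInverse hT hTinj
  have hqz : q 1 = z₀ := rfl
  have hΨ₀ : ContDiffAt ℝ ∞ Ψ (φ 1) := hΨ.contDiffAt (Metric.ball_mem_nhds _ hr)
  have hT₀ : T z₀ = (φ 1, Ψ (φ 1)) := by
    simp only [T]
    rw [← hqz, hΘΨ 1 h1V']
  have hφ1 : ContMDiffAt I 𝓘(ℝ, EG) ∞ φ 1 := contMDiffAt_extChartAt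
  have hloc : ContMDiffAt I 𝓘(ℝ, EA) ∞ (fun t => (g (φ t, Ψ (φ t))).2) 1 := by
    have h1 : ContDiffAt ℝ ∞ (fun x => (g (x, Ψ x)).2) (φ 1) := by
      refine contDiffAt_snd.comp _ (ContDiffAt.comp (f := fun x => (x, Ψ x)) (φ 1) ?_
        (contDiffAt_id.prodMk hΨ₀))
      rw [← hT₀]; exact hg
    exact ContMDiffAt.comp (g := fun x => (g (x, Ψ x)).2) (1 : G) h1.contMDiffAt hφ1
  have hev : (fun t => κ (c t)) =ᶠ[𝓝 1] fun t => (g (φ t, Ψ (φ t))).2 := by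
    filter_upwards [hqc.eventually (by rw [hqz]; exact hgT), hV'n] with t ht htV'
    have : T (q t) = (φ t, Ψ (φ t)) := by
      simp only [T]
      rw [hΘΨ t htV']
    rw [this] at ht
    rw [ht]
  have hκc : ContMDiffAt I 𝓘(ℝ, EA) ∞ (fun t => κ (c t)) 1 := hloc.congr_of_eventuallyEq hev
  have hκs : ContMDiffAt 𝓘(ℝ, EA) J ∞ κ.symm (κ (c 1)) :=
    (contMDiffOn_extChartAt_symm (c 1)).contMDiffAt (extChartAt_target_mem_nhds (I := J) (c 1))
  have hfinal : ContMDiffAt I J ∞ (fun t => κ.symm (κ (c t))) 1 :=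
    ContMDiffAt.comp (f := fun t => κ (c t)) (1 : G) hκs hκc
  refine hfinal.congr_of_eventuallyEq ?_
  filter_upwards [hVo.mem_nhds h1V] with t ht
  exact (κ.left_inv (hVκ t ht)).symm

end AutomaticSmoothness

/-! ### Gluing a manifold from patches -/

section Gluing

variable {X N ι EN HN V : Type*} [NormedAddCommGroup EN] [NormedSpace ℝ EN] [TopologicalSpace HN]
  {K : ModelWithCorners ℝ EN HN} [TopologicalSpace N] [ChartedSpace HN N]
  [NormedAddCommGroup V] [NormedSpace ℝ V]

/-- The chart of a glued manifold given by a patch followed by a chart of the manifold `N`. -/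
noncomputable def patchChart (K : ModelWithCorners ℝ EN HN) (L : EN ≃L[ℝ] V)
    (θ : PartialEquiv X N) (n : N) : PartialEquiv X V :=
  (θ.trans (extChartAt K n)).trans L.toEquiv.toPartialEquiv

theorem patchChart_symm_apply (L : EN ≃L[ℝ] V) (θ : PartialEquiv X N) (n : N) (v : V) :
    (patchChart K L θ n).symm v = θ.symm ((extChartAt K n).symm (L.symm v)) := rfl

theorem mem_patchChart_source {L : EN ≃L[ℝ] V} {θ : PartialEquiv X N} {n : N} {x : X} :
    x ∈ (patchChart K L θ n).source ↔ x ∈ θ.source ∧ θ x ∈ (extChartAt K n).source := by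
  simp [patchChart]

theorem mem_patchChart_target {L : EN ≃L[ℝ] V} {θ : PartialEquiv X N} {n : N} {v : V} :
    v ∈ (patchChart K L θ n).target ↔
      L.symm v ∈ (extChartAt K n).target ∧ (extChartAt K n).symm (L.symm v) ∈ θ.target := by
  simp only [patchChart, PartialEquiv.trans_target, Equiv.toPartialEquiv_target, Set.mem_inter_iff,
    Set.mem_univ, true_and, Set.mem_preimage]
  rfl

variable [K.Boundaryless]

theorem isOpen_patchChart_trans_source (L : EN ≃L[ℝ] V) {θ θ' : PartialEquiv X N}
    (hopen : IsOpen (θ.symm.trans θ').source)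
    (hcont : ContinuousOn (θ.symm.trans θ') (θ.symm.trans θ').source) (n n' : N) :
    IsOpen ((patchChart K L θ n).symm.trans (patchChart K L θ' n')).source := by
  have h1 : IsOpen ((θ.symm.trans θ').source ∩ (θ.symm.trans θ') ⁻¹' (extChartAt K n').source) :=
    hcont.isOpen_inter_preimage hopen (isOpen_extChartAt_source n')
  have h2 := (continuousOn_extChartAt_symm (I := K) n).isOpen_inter_preimage
    (isOpen_extChartAt_target n) h1
  convert h2.preimage L.symm.continuous using 1
  ext v
  simp only [PartialEquiv.trans_source, PartialEquiv.symm_source, Set.mem_inter_iff,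
    mem_patchChart_target, Set.mem_preimage, mem_patchChart_source, patchChart_symm_apply,
    PartialEquiv.coe_trans, Function.comp_apply]
  tauto

variable [IsManifold K ∞ N]

theorem contDiffOn_patchChart_trans (L : EN ≃L[ℝ] V) {θ θ' : PartialEquiv X N}
    (hopen : IsOpen (θ.symm.trans θ').source)
    (hsmooth : ContMDiffOn K K ∞ (θ.symm.trans θ') (θ.symm.trans θ').source) (n n' : N) :
    ContDiffOn ℝ ∞ ((patchChart K L θ n).symm.trans (patchChart K L θ' n'))
      ((patchChart K L θ n).symm.trans (patchChart K L θ' n')).source := by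
  intro v hv
  simp only [PartialEquiv.trans_source, PartialEquiv.symm_source, Set.mem_inter_iff,
    mem_patchChart_target, Set.mem_preimage, mem_patchChart_source, patchChart_symm_apply] at hv
  obtain ⟨⟨h1, h2⟩, h3, h4⟩ := hv
  apply ContDiffAt.contDiffWithinAt
  rw [← contMDiffAt_iff_contDiffAt]
  have a1 : ContMDiffAt 𝓘(ℝ, V) K ∞ (fun v => (extChartAt K n).symm (L.symm v)) v :=
    ContMDiffAt.comp v ((contMDiffOn_extChartAt_symm n).contMDiffAt
      ((isOpen_extChartAt_target n).mem_nhds h1)) L.symm.contDiff.contDiffAt.contMDiffAt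
  have a2 : ContMDiffAt K K ∞ (θ.symm.trans θ') ((extChartAt K n).symm (L.symm v)) :=
    hsmooth.contMDiffAt (hopen.mem_nhds (by simpa [PartialEquiv.trans_source] using ⟨h2, h3⟩))
  have a3 : ContMDiffAt K 𝓘(ℝ, EN) ∞ (extChartAt K n')
      ((θ.symm.trans θ') ((extChartAt K n).symm (L.symm v))) := by
    apply contMDiffAt_extChartAt'
    rwa [← extChartAt_source K]
  have a4 : ContMDiffAt 𝓘(ℝ, V) 𝓘(ℝ, EN) ∞ (fun v => extChartAt K n'
      ((θ.symm.trans θ') ((extChartAt K n).symm (L.symm v)))) v :=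
    ContMDiffAt.comp v a3 (ContMDiffAt.comp v a2 a1)
  exact ContMDiffAt.comp (I' := 𝓘(ℝ, EN)) (g := fun x => L x) v
    L.contDiff.contDiffAt.contMDiffAt a4

/-- The atlas of a glued manifold. -/
noncomputable def gluedCore (K : ModelWithCorners ℝ EN HN) [K.Boundaryless] [IsManifold K ∞ N]
    (L : EN ≃L[ℝ] V) (θ : ι → PartialEquiv X N)
    (hopen : ∀ i j, IsOpen ((θ i).symm.trans (θ j)).source)
    (hsmooth : ∀ i j, ContMDiffOn K K ∞ ((θ i).symm.trans (θ j)) ((θ i).symm.trans (θ j)).source)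
    (index : X → ι) (hindex : ∀ x, x ∈ (θ (index x)).source) : ChartedSpaceCore V X where
  atlas := {e | ∃ i n, e = patchChart K L (θ i) n}
  chartAt x := patchChart K L (θ (index x)) (θ (index x) x)
  mem_chart_source x := mem_patchChart_source.2 ⟨hindex x, mem_extChartAt_source _⟩
  chart_mem_atlas x := ⟨_, _, rfl⟩
  open_source := by
    rintro _ _ ⟨i, n, rfl⟩ ⟨j, m, rfl⟩
    exact isOpen_patchChart_trans_source L (hopen i j) (hsmooth i j).continuousOn n m
  continuousOn_toFun := by
    rintro _ _ ⟨i, n, rfl⟩ ⟨j, m, rfl⟩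
    exact (contDiffOn_patchChart_trans L (hopen i j) (hsmooth i j) n m).continuousOn

/-- A set covered by patches with smooth transition maps carries a structure of manifold such that
the patches are open and are diffeomorphic to open subsets of the given manifold. -/
theorem exists_isManifold_of_patches (L : EN ≃L[ℝ] V) (θ : ι → PartialEquiv X N)
    (hopen : ∀ i j, IsOpen ((θ i).symm.trans (θ j)).source)
    (hsmooth : ∀ i j, ContMDiffOn K K ∞ ((θ i).symm.trans (θ j)) ((θ i).symm.trans (θ j)).source)
    (hcover : ∀ x, ∃ i, x ∈ (θ i).source) :
    ∃ (_ : TopologicalSpace X) (_ : ChartedSpace V X), IsManifold 𝓘(ℝ, V) ∞ X ∧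
      ∀ i, IsOpen (θ i).source ∧ ContMDiffOn 𝓘(ℝ, V) K ∞ (θ i) (θ i).source ∧
        ContMDiffOn K 𝓘(ℝ, V) ∞ (θ i).symm (θ i).target := by
  choose index hindex using hcover
  -- X comes without a topology: the atlas of patch charts creates it, so only the transition maps
  -- have to be controlled.
  let core := gluedCore K L θ hopen hsmooth index hindex
  let : TopologicalSpace X := core.toTopologicalSpace
  let : ChartedSpace V X := core.toChartedSpace
  have hman : IsManifold 𝓘(ℝ, V) ∞ X := by
    refine isManifold_of_contDiffOn 𝓘(ℝ, V) ∞ X fun e e' he he' => ?_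
    obtain ⟨f, hf, hfe⟩ := Set.mem_iUnion₂.1 he
    obtain ⟨f', hf', hfe'⟩ := Set.mem_iUnion₂.1 he'
    rw [Set.mem_singleton_iff] at hfe hfe'
    subst hfe hfe'
    obtain ⟨i, n, rfl⟩ := hf
    obtain ⟨j, m, rfl⟩ := hf'
    refine (contDiffOn_patchChart_trans L (hopen i j) (hsmooth i j) n m).congr_mono ?_ ?_
    · intro x _; rfl
    · rintro x ⟨hx, -⟩; exact hx
  refine ⟨inferInstance, inferInstance, hman, fun i => ?_⟩
  let E : N → OpenPartialHomeomorph X V := fun n =>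
    core.openPartialHomeomorph (patchChart K L (θ i) n) ⟨i, n, rfl⟩
  have hE : ∀ n, E n ∈ IsManifold.maximalAtlas 𝓘(ℝ, V) ∞ X := fun n =>
    IsManifold.subset_maximalAtlas (Set.mem_iUnion₂.2 ⟨_, ⟨i, n, rfl⟩, rfl⟩)
  have hEs : ∀ n x, x ∈ (E n).source ↔ x ∈ (θ i).source ∧ θ i x ∈ (extChartAt K n).source :=
    fun n x => mem_patchChart_source
  have htarget : IsOpen (θ i).target := by
    have := hopen i i
    rwa [PartialEquiv.trans_source, PartialEquiv.symm_source,
      Set.inter_eq_left.2 (θ i).target_subset_preimage_source] at this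
  refine ⟨?_, ?_, ?_⟩
  · rw [isOpen_iff_mem_nhds]
    intro x hx
    exact mem_of_superset ((E (θ i x)).open_source.mem_nhds
      ((hEs _ _).2 ⟨hx, mem_extChartAt_source _⟩)) fun y hy => ((hEs _ _).1 hy).1
  · intro x hx
    have hxE : x ∈ (E (θ i x)).source := (hEs _ _).2 ⟨hx, mem_extChartAt_source _⟩
    have a1 : ContMDiffAt 𝓘(ℝ, V) 𝓘(ℝ, V) ∞ (E (θ i x)) x :=
      contMDiffAt_of_mem_maximalAtlas (hE _) hxE
    have a2 : ContMDiffAt 𝓘(ℝ, EN) K ∞ (extChartAt K (θ i x)).symm (L.symm (E (θ i x) x)) := by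
      have : L.symm (E (θ i x) x) = extChartAt K (θ i x) (θ i x) := L.symm_apply_apply _
      rw [this]
      exact (contMDiffOn_extChartAt_symm _).contMDiffAt (extChartAt_target_mem_nhds (I := K) _)
    have a3 : ContMDiffAt 𝓘(ℝ, V) K ∞
        (fun y => (extChartAt K (θ i x)).symm (L.symm (E (θ i x) y))) x :=
      ContMDiffAt.comp x a2 (ContMDiffAt.comp x L.symm.contDiff.contDiffAt.contMDiffAt a1)
    refine (a3.congr_of_eventuallyEq ?_).contMDiffWithinAt
    filter_upwards [(E (θ i x)).open_source.mem_nhds hxE] with y hy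
    have : L.symm (E (θ i x) y) = extChartAt K (θ i x) (θ i y) := L.symm_apply_apply _
    rw [this, (extChartAt K (θ i x)).left_inv ((hEs _ _).1 hy).2]
  · intro p hp
    have b1 : ContMDiffAt K 𝓘(ℝ, V) ∞ (fun y => L (extChartAt K p y)) p :=
      ContMDiffAt.comp p L.contDiff.contDiffAt.contMDiffAt contMDiffAt_extChartAt
    have b2 : ContMDiffAt 𝓘(ℝ, V) 𝓘(ℝ, V) ∞ (E p).symm (L (extChartAt K p p)) := by
      refine contMDiffAt_symm_of_mem_maximalAtlas (hE p) ?_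
      refine mem_patchChart_target.2 ?_
      rw [L.symm_apply_apply, extChartAt_to_inv]
      exact ⟨mem_extChartAt_target p, hp⟩
    have b3 : ContMDiffAt K 𝓘(ℝ, V) ∞ (fun y => (E p).symm (L (extChartAt K p y))) p :=
      ContMDiffAt.comp p b2 b1
    refine (b3.congr_of_eventuallyEq ?_).contMDiffWithinAt
    filter_upwards [extChartAt_source_mem_nhds (I := K) p] with y hy
    have : (E p).symm (L (extChartAt K p y)) = (θ i).symm ((extChartAt K p).symm
      (L.symm (L (extChartAt K p y)))) := rfl
    rw [this, L.symm_apply_apply, (extChartAt K p).left_inv hy]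

end Gluing

/-! ### Algebra of the twisted product -/

section TwistedProduct

universe u v

/-- A `2`-cocycle of `G` with values in `A` that vanishes at the identity. -/
structure NormalizedCocycle (G : Type u) (A : Type v) [Group G] [AddCommGroup A]
    [DistribMulAction G A] where
  /-- The underlying function. -/
  toFun : G × G → A
  d2_eq_zero : d2 G A toFun = 0
  map_one_one : toFun (1, 1) = 0

namespace NormalizedCocycle

variable {G : Type u} {A : Type v} [Group G] [AddCommGroup A] [DistribMulAction G A]

instance : CoeFun (NormalizedCocycle G A) fun _ => G × G → A := ⟨toFun⟩

variable (F : NormalizedCocycle G A)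

theorem cocycle (s t u : G) : s • F (t, u) + F (s, t * u) = F (s * t, u) + F (s, t) := by
  have h := congrFun F.d2_eq_zero (s, t, u)
  simp only [d2, AddMonoidHom.coe_mk, ZeroHom.coe_mk, Pi.zero_apply] at h
  rw [← sub_eq_zero, ← h]
  abel

theorem map_one_left (t : G) : F (1, t) = 0 := by
  have h := F.cocycle 1 1 t
  rw [one_smul, one_mul, one_mul, F.map_one_one, add_zero] at h
  simpa using h

theorem map_one_right (s : G) : F (s, 1) = 0 := by
  have h := F.cocycle s 1 1
  simpa [F.map_one_one] using h

theorem cocycle_eq (s t u : G) : F (s, t * u) = F (s * t, u) + F (s, t) - s • F (t, u) := by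
  rw [← F.cocycle]; abel

end NormalizedCocycle
/-- The group extension of `G` by `A` defined by a normalized cocycle. -/
@[ext]
structure TwistedProduct {G : Type u} {A : Type v} [Group G] [AddCommGroup A]
    [DistribMulAction G A] (F : NormalizedCocycle G A) where
  /-- The component in `A`. -/
  left : A
  /-- The component in `G`. -/
  right : G

namespace TwistedProduct

variable {G : Type u} {A : Type v} [Group G] [AddCommGroup A] [DistribMulAction G A]
  {F : NormalizedCocycle G A}

instance : Mul (TwistedProduct F) :=
  ⟨fun e e' => ⟨e.left + e.right • e'.left + F (e.right, e'.right), e.right * e'.right⟩⟩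

instance : One (TwistedProduct F) := ⟨⟨0, 1⟩⟩

instance : Inv (TwistedProduct F) :=
  ⟨fun e => ⟨-(e.right⁻¹ • e.left) - F (e.right⁻¹, e.right), e.right⁻¹⟩⟩

@[simp] theorem mul_left (e e' : TwistedProduct F) :
    (e * e').left = e.left + e.right • e'.left + F (e.right, e'.right) := rfl
@[simp] theorem mul_right (e e' : TwistedProduct F) : (e * e').right = e.right * e'.right := rfl
@[simp] theorem one_left : (1 : TwistedProduct F).left = 0 := rfl
@[simp] theorem one_right : (1 : TwistedProduct F).right = 1 := rfl

instance : Group (TwistedProduct F) :=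
  Group.ofLeftAxioms
    (fun e e' e'' => by
      ext
      · simp only [mul_left, mul_right, smul_add, mul_smul, F.cocycle_eq e.right]
        abel
      · simp [mul_assoc])
    (fun e => by
      ext
      · simp [F.map_one_left]
      · simp)
    (fun e => by
      ext
      · change -(e.right⁻¹ • e.left) - F (e.right⁻¹, e.right) + e.right⁻¹ • e.left
          + F (e.right⁻¹, e.right) = 0
        abel
      · exact inv_mul_cancel e.right)

variable (F) in
/-- The extension `0 → A → TwistedProduct F → G → 1`. -/
def groupExtension : GroupExtension (Multiplicative A) (TwistedProduct F) G where
  inl :=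
    { toFun := fun a => ⟨a.toAdd, 1⟩
      map_one' := rfl
      map_mul' := fun a b => by ext <;> simp [F.map_one_one] }
  rightHom :=
    { toFun := right
      map_one' := rfl
      map_mul' := fun _ _ => rfl }
  inl_injective := fun a b h => congrArg left h
  range_inl_eq_ker_rightHom := by
    ext e
    constructor
    · rintro ⟨a, rfl⟩; rfl
    · intro h
      exact ⟨Multiplicative.ofAdd e.left, TwistedProduct.ext rfl (Eq.symm h)⟩
  rightHom_surjective := fun g => ⟨⟨0, g⟩, rfl⟩

/-- The inclusion of `A`. -/
def ofLeft (F : NormalizedCocycle G A) (a : A) : TwistedProduct F := ⟨a, 1⟩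

/-- The canonical cross section. -/
def ofRight (F : NormalizedCocycle G A) (g : G) : TwistedProduct F := ⟨0, g⟩

theorem ofLeft_add (a b : A) : ofLeft F (a + b) = ofLeft F a * ofLeft F b := by
  ext <;> simp [ofLeft, F.map_one_one]

theorem ofRight_mul_ofLeft (g : G) (a : A) :
    ofRight F g * ofLeft F a = ofLeft F (g • a) * ofRight F g := by
  ext <;> simp [ofLeft, ofRight, F.map_one_left, F.map_one_right]

theorem ofRight_mul_ofRight (g h : G) :
    ofRight F g * ofRight F h = ofLeft F (F (g, h)) * ofRight F (g * h) := by
  ext <;> simp [ofLeft, ofRight, F.map_one_left]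

theorem ofRight_one : ofRight F 1 = 1 := rfl

theorem ofLeft_mul_ofRight (a : A) (g : G) : ofLeft F a * ofRight F g = ⟨a, g⟩ := by
  ext <;> simp [ofLeft, ofRight, F.map_one_left]

theorem conj_ofLeft (e : TwistedProduct F) (a : A) :
    e * ofLeft F a * e⁻¹ = ofLeft F (e.right • a) := by
  rw [mul_inv_eq_iff_eq_mul]
  ext
  · simp [ofLeft, F.map_one_left, F.map_one_right, add_comm]
  · simp [ofLeft]

/-- The failure of the canonical cross section to commute with conjugation by `y`. -/
def conjDefect (F : NormalizedCocycle G A) (y v : G) : A := F (v, y) - F (y, y⁻¹ * v * y)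

theorem ofRight_mul_ofRight_comm (v y : G) :
    ofRight F v * ofRight F y =
      ofLeft F (conjDefect F y v) * (ofRight F y * ofRight F (y⁻¹ * v * y)) := by
  rw [ofRight_mul_ofRight, ofRight_mul_ofRight, ← mul_assoc, ← ofLeft_add, conjDefect]
  congr 2
  · rw [sub_add_cancel]
  · group

/-- With y fixed, σ(v) is the conjugated section v ↦ σ(y) σ(y⁻¹vy) σ(y)⁻¹ multiplied by `conjDefect
F y v`. The conjugated section has cocycle y • F(y⁻¹vy, y⁻¹wy), so the two cocycles differ by this
coboundary. The point is that the right-hand side only involves F near (1,1) when v and w are near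
1. -/
theorem d1_conjDefect (y v w : G) : d1 G A (conjDefect F y) (v, w) =
    F (v, w) - y • F (y⁻¹ * v * y, y⁻¹ * w * y) := by
  have h1 := F.cocycle y (y⁻¹ * v * y) (y⁻¹ * w * y)
  have h2 := F.cocycle v y (y⁻¹ * w * y)
  have h3 := F.cocycle v w y
  have e1 : y * (y⁻¹ * v * y) = v * y := by group
  have e2 : y * (y⁻¹ * w * y) = w * y := by group
  have e3 : y⁻¹ * v * y * (y⁻¹ * w * y) = y⁻¹ * (v * w) * y := by group
  rw [e1, e3] at h1
  rw [e2] at h2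
  rw [← sub_eq_zero] at h1 h2 h3 ⊢
  -- Alternating sum of the cocycle identities at (y, y⁻¹vy, y⁻¹wy), (v, y, y⁻¹wy) and (v, w, y).
  have h : (F (v, w) - y • F (y⁻¹ * v * y, y⁻¹ * w * y)) - d1 G A (conjDefect F y) (v, w) =
      - (y • F (y⁻¹ * v * y, y⁻¹ * w * y) + F (y, y⁻¹ * (v * w) * y)
        - (F (v * y, y⁻¹ * w * y) + F (y, y⁻¹ * v * y)))
      + (v • F (y, y⁻¹ * w * y) + F (v, w * y) - (F (v * y, y⁻¹ * w * y) + F (v, y)))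
      - (v • F (w, y) + F (v, w * y) - (F (v * w, y) + F (v, w))) := by
    simp only [d1, AddMonoidHom.coe_mk, ZeroHom.coe_mk, conjDefect, smul_sub]
    abel
  rw [h1, h2, h3] at h
  rw [← neg_sub, h]
  simp

/-- The parametrization `(α, v) ↦ α σ(g) σ(v)` of the twisted product. -/
def patchMap (F : NormalizedCocycle G A) (g : G) (p : A × G) : TwistedProduct F :=
  ofLeft F p.1 * (ofRight F g * ofRight F p.2)

theorem patchMap_eq (g : G) (p : A × G) : patchMap F g p = ⟨p.1 + F (g, p.2), g * p.2⟩ := by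
  rw [patchMap, ofRight_mul_ofRight, ← mul_assoc, ← ofLeft_add, ofLeft_mul_ofRight]

theorem patchMap_right (g : G) (p : A × G) : (patchMap F g p).right = g * p.2 := by
  rw [patchMap_eq]

/-- The inverse of `patchMap`. -/
def patchCoord (F : NormalizedCocycle G A) (g : G) (e : TwistedProduct F) : A × G :=
  (e.left - F (g, g⁻¹ * e.right), g⁻¹ * e.right)

theorem patchMap_patchCoord (g : G) (e : TwistedProduct F) :
    patchMap F g (patchCoord F g e) = e := by
  rw [patchMap_eq, patchCoord]
  ext <;> simp

theorem patchCoord_patchMap (g : G) (p : A × G) :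
    patchCoord F g (patchMap F g p) = p := by
  rw [patchMap_eq, patchCoord]
  ext <;> simp

/-- In α σ(x) σ(v) β σ(y) σ(w), elements of A are moved to the left and σ(y) is moved past σ(v). For
fixed x and y, the only non-constant values of F that remain are `conjDefect F y` at v and F at
(y⁻¹vy, w), which is near (1,1) when v and w are near 1. -/
theorem patchMap_mul_patchMap (x y : G) (p q : A × G) :
    patchMap F x p * patchMap F y q = patchMap F (x * y)
      (p.1 + (x * p.2) • q.1 + x • conjDefect F y p.2 + F (x, y)
        + (x * y) • F (y⁻¹ * p.2 * y, q.2), y⁻¹ * p.2 * y * q.2) := by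
  obtain ⟨α, v⟩ := p
  obtain ⟨β, w⟩ := q
  have hr : ∀ (g : G) (a : A) (e : TwistedProduct F),
      ofRight F g * (ofLeft F a * e) = ofLeft F (g • a) * (ofRight F g * e) := fun g a e => by
    rw [← mul_assoc, ofRight_mul_ofLeft, mul_assoc]
  have hxy : ∀ (e : TwistedProduct F), ofRight F x * (ofRight F y * e) =
      ofLeft F (F (x, y)) * (ofRight F (x * y) * e) := fun e => by
    rw [← mul_assoc, ofRight_mul_ofRight, mul_assoc]
  have hvy : ∀ (e : TwistedProduct F), ofRight F v * (ofRight F y * e) =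
      ofLeft F (conjDefect F y v) * (ofRight F y * (ofRight F (y⁻¹ * v * y) * e)) := fun e => by
    rw [← mul_assoc, ofRight_mul_ofRight_comm, mul_assoc, mul_assoc]
  simp only [patchMap, mul_assoc _ _ (ofLeft F β * _)]
  rw [mul_assoc, mul_assoc, hr, hvy, ofRight_mul_ofRight (y⁻¹ * v * y) w, hr, hr, hr, hr, hxy]
  simp only [← mul_assoc, ← ofLeft_add, mul_smul]
  congr 3
  abel

theorem ofRight_inv (v : G) : (ofRight F v)⁻¹ = patchMap F 1 (-F (v⁻¹, v), v⁻¹) := by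
  refine inv_eq_of_mul_eq_one_left ?_
  rw [patchMap, ofRight_one, one_mul, mul_assoc, ofRight_mul_ofRight, ← mul_assoc, ← ofLeft_add]
  ext <;> simp [ofLeft, ofRight, F.map_one_left]

end TwistedProduct

end TwistedProduct

/-! ### The Lie group structure on the twisted product -/

namespace TwistedProduct

universe u v

section Patch

variable {G : Type u} {A : Type v} [Group G] [AddCommGroup A] [DistribMulAction G A]
  {F : NormalizedCocycle G A} {U : Set G}

/-- The patch of the twisted product over the translate `g U`. -/
def patch (F : NormalizedCocycle G A) (U : Set G) (g : G) :
    PartialEquiv (TwistedProduct F) (A × G) where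
  toFun := patchCoord F g
  invFun := patchMap F g
  source := {e | g⁻¹ * e.right ∈ U}
  target := {p | p.2 ∈ U}
  map_source' := fun _ he => he
  map_target' := fun p hp => by simpa [patchMap_right] using hp
  left_inv' := fun e _ => patchMap_patchCoord g e
  right_inv' := fun p _ => patchCoord_patchMap g p

theorem mem_patch_trans_source {g h : G} {p : A × G} :
    p ∈ ((patch F U g).symm.trans (patch F U h)).source ↔ p.2 ∈ U ∧ h⁻¹ * (g * p.2) ∈ U := by
  simp only [PartialEquiv.trans_source, PartialEquiv.symm_source, Set.mem_inter_iff,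
    Set.mem_preimage]
  refine and_congr Iff.rfl ?_
  change h⁻¹ * (patchMap F g p).right ∈ U ↔ _
  rw [patchMap_right]

end Patch

variable {EG HG EA HA V : Type*} {G : Type u} {A : Type v}
  [NormedAddCommGroup EG] [NormedSpace ℝ EG] [TopologicalSpace HG]
  {I : ModelWithCorners ℝ EG HG}
  [Group G] [TopologicalSpace G] [ChartedSpace HG G]
  [NormedAddCommGroup EA] [NormedSpace ℝ EA] [TopologicalSpace HA]
  {J : ModelWithCorners ℝ EA HA}
  [AddCommGroup A] [TopologicalSpace A] [ChartedSpace HA A] [DistribMulAction G A]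
  {F : NormalizedCocycle G A} {U : Set G}
  [NormedAddCommGroup V] [NormedSpace ℝ V]

theorem isOpen_patch_trans_source [IsTopologicalGroup G] (hU : IsOpen U) (g h : G) :
    IsOpen ((patch F U g).symm.trans (patch F U h)).source := by
  have : ((patch F U g).symm.trans (patch F U h)).source =
      (fun p : A × G => p.2) ⁻¹' U ∩ (fun p : A × G => h⁻¹ * (g * p.2)) ⁻¹' U :=
    Set.ext fun p => mem_patch_trans_source
  rw [this]
  exact (hU.preimage (by fun_prop)).inter (hU.preimage (by fun_prop))

variable (V I J F U) in
/-- The twisted product carries a smooth structure for which the patches are diffeomorphisms. -/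
structure HasSmoothPatches [TopologicalSpace (TwistedProduct F)]
    [ChartedSpace V (TwistedProduct F)] : Prop where
  isManifold : IsManifold 𝓘(ℝ, V) ∞ (TwistedProduct F)
  isOpen_source : ∀ g : G, IsOpen {e : TwistedProduct F | g⁻¹ * e.right ∈ U}
  contMDiffAt_coord : ∀ (g : G) (e : TwistedProduct F), g⁻¹ * e.right ∈ U →
    ContMDiffAt 𝓘(ℝ, V) (J.prod I) ∞ (patchCoord F g) e
  contMDiffAt_map : ∀ (g : G) (p : A × G), p.2 ∈ U →
    ContMDiffAt (J.prod I) 𝓘(ℝ, V) ∞ (patchMap F g) p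

section LieGroup

variable [TopologicalSpace (TwistedProduct F)] [ChartedSpace V (TwistedProduct F)]

theorem HasSmoothPatches.contMDiff_ofLeft (h : HasSmoothPatches V I J F U) (h1 : 1 ∈ U) :
    ContMDiff J 𝓘(ℝ, V) ∞ (ofLeft F) := by
  intro a
  have hm := h.contMDiffAt_map 1 (a, 1) h1
  have : ContMDiffAt J 𝓘(ℝ, V) ∞ (fun a' => patchMap F 1 (a', 1)) a :=
    ContMDiffAt.comp (f := fun a' : A => (a', (1 : G))) a hm
      (contMDiffAt_id.prodMk contMDiffAt_const)
  refine this.congr_of_eventuallyEq (Eventually.of_forall fun a' => ?_)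
  simp [patchMap_eq, ofLeft, F.map_one_one]

theorem HasSmoothPatches.contMDiffAt_ofRight (h : HasSmoothPatches V I J F U) {g : G}
    (hg : g ∈ U) : ContMDiffAt I 𝓘(ℝ, V) ∞ (ofRight F) g := by
  have hm := h.contMDiffAt_map 1 (0, g) hg
  have : ContMDiffAt I 𝓘(ℝ, V) ∞ (fun g' => patchMap F 1 (0, g')) g :=
    ContMDiffAt.comp (f := fun g' : G => ((0 : A), g')) g hm
      (contMDiffAt_const.prodMk contMDiffAt_id)
  refine this.congr_of_eventuallyEq (Eventually.of_forall fun g' => ?_)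
  simp [patchMap_eq, ofRight, F.map_one_left]

variable [LieGroup I ∞ G]

theorem HasSmoothPatches.contMDiff_right (h : HasSmoothPatches V I J F U) (h1 : 1 ∈ U) :
    ContMDiff 𝓘(ℝ, V) I ∞ (right : TwistedProduct F → G) := by
  intro e
  have hc := h.contMDiffAt_coord e.right e (by simpa using h1)
  have : ContMDiffAt 𝓘(ℝ, V) I ∞ (fun e' => e.right * (patchCoord F e.right e').2) e :=
    contMDiffAt_const.mul hc.snd
  refine this.congr_of_eventuallyEq (Eventually.of_forall fun e' => ?_)
  simp [patchCoord]

variable [LieAddGroup J ∞ A] [ContMDiffSMul I J ∞ G A]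

/-- Reading e and e' in the patches centred at their own images in G makes both G-coordinates equal
to 1, so smoothness of `conjDefect F y` is needed only at 1. -/
theorem HasSmoothPatches.contMDiff_mul (h : HasSmoothPatches V I J F U) (h1 : 1 ∈ U)
    (hF : ∀ s ∈ U, ∀ t ∈ U, ContMDiffAt (I.prod I) J ∞ F (s, t))
    (hconj : ∀ y, ContMDiffAt I J ∞ (conjDefect F y) 1) :
    ContMDiff (𝓘(ℝ, V).prod 𝓘(ℝ, V)) 𝓘(ℝ, V) ∞
      (fun p : TwistedProduct F × TwistedProduct F => p.1 * p.2) := by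
  rintro ⟨e, e'⟩
  set x := e.right with hx
  set y := e'.right with hy
  let W := TwistedProduct F × TwistedProduct F
  have c1 : ContMDiffAt (𝓘(ℝ, V).prod 𝓘(ℝ, V)) (J.prod I) ∞
      (fun p : W => patchCoord F x p.1) (e, e') :=
    ContMDiffAt.comp (f := Prod.fst) (e, e')
      (h.contMDiffAt_coord x e (by simpa [hx] using h1)) contMDiffAt_fst
  have c2 : ContMDiffAt (𝓘(ℝ, V).prod 𝓘(ℝ, V)) (J.prod I) ∞
      (fun p : W => patchCoord F y p.2) (e, e') :=
    ContMDiffAt.comp (f := Prod.snd) (e, e')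
      (h.contMDiffAt_coord y e' (by simpa [hy] using h1)) contMDiffAt_snd
  have hv : (patchCoord F x e).2 = 1 := by simp [patchCoord, hx]
  have hw : (patchCoord F y e').2 = 1 := by simp [patchCoord, hy]
  have hv' : ContMDiffAt (𝓘(ℝ, V).prod 𝓘(ℝ, V)) I ∞
      (fun p : W => y⁻¹ * (patchCoord F x p.1).2 * y) (e, e') :=
    (contMDiffAt_const.mul c1.snd).mul contMDiffAt_const
  have d1 : ContMDiffAt (𝓘(ℝ, V).prod 𝓘(ℝ, V)) J ∞
      (fun p : W => (x * (patchCoord F x p.1).2) • (patchCoord F y p.2).1) (e, e') :=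
    ContMDiffAt.smul (I := I) (contMDiffAt_const.mul c1.snd) c2.fst
  have d2 : ContMDiffAt (𝓘(ℝ, V).prod 𝓘(ℝ, V)) J ∞
      (fun p : W => x • conjDefect F y (patchCoord F x p.1).2) (e, e') := by
    refine ContMDiffAt.smul (I := I) contMDiffAt_const
      (ContMDiffAt.comp (f := fun p : W => (patchCoord F x p.1).2) (g := conjDefect F y) (e, e')
        ?_ c1.snd)
    simp only
    rw [hv]; exact hconj y
  have d3 : ContMDiffAt (𝓘(ℝ, V).prod 𝓘(ℝ, V)) J ∞
      (fun p : W => (x * y) • F (y⁻¹ * (patchCoord F x p.1).2 * y, (patchCoord F y p.2).2))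
      (e, e') := by
    refine ContMDiffAt.smul (I := I) contMDiffAt_const
      (ContMDiffAt.comp (I' := I.prod I) (f := fun p : W =>
        (y⁻¹ * (patchCoord F x p.1).2 * y, (patchCoord F y p.2).2)) (g := F) (e, e') ?_
        (hv'.prodMk c2.snd))
    simp only
    rw [hv, hw, mul_one, inv_mul_cancel]; exact hF 1 h1 1 h1
  have hfst : ContMDiffAt (𝓘(ℝ, V).prod 𝓘(ℝ, V)) J ∞ (fun p : W =>
      (patchCoord F x p.1).1 + (x * (patchCoord F x p.1).2) • (patchCoord F y p.2).1
        + x • conjDefect F y (patchCoord F x p.1).2 + F (x, y)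
        + (x * y) • F (y⁻¹ * (patchCoord F x p.1).2 * y, (patchCoord F y p.2).2)) (e, e') :=
    (((c1.fst.add d1).add d2).add contMDiffAt_const).add d3
  have hsnd : ContMDiffAt (𝓘(ℝ, V).prod 𝓘(ℝ, V)) I ∞ (fun p : W =>
      y⁻¹ * (patchCoord F x p.1).2 * y * (patchCoord F y p.2).2) (e, e') := hv'.mul c2.snd
  have hcomp := ContMDiffAt.comp (I' := J.prod I) (g := patchMap F (x * y)) (e, e')
    (h.contMDiffAt_map (x * y) _ (by
      simp only
      rw [hv, hw, mul_one, mul_one, inv_mul_cancel]; exact h1)) (hfst.prodMk hsnd)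
  refine hcomp.congr_of_eventuallyEq (Eventually.of_forall fun p => ?_)
  simp only [Function.comp_apply]
  rw [← patchMap_mul_patchMap, patchMap_patchCoord, patchMap_patchCoord]

/-- For e' = α σ(x) σ(v), the inverse is σ(v)⁻¹ σ(x)⁻¹ (-α). With multiplication already smooth,
only v ↦ σ(v)⁻¹ near v = 1 remains, and there `ofRight_inv` involves F near (1,1). -/
theorem HasSmoothPatches.lieGroup (h : HasSmoothPatches V I J F U) (h1 : 1 ∈ U)
    (hF : ∀ s ∈ U, ∀ t ∈ U, ContMDiffAt (I.prod I) J ∞ F (s, t))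
    (hconj : ∀ y, ContMDiffAt I J ∞ (conjDefect F y) 1) :
    LieGroup 𝓘(ℝ, V) ∞ (TwistedProduct F) := by
  have hman := h.isManifold
  have hmul : ContMDiffMul 𝓘(ℝ, V) ∞ (TwistedProduct F) :=
    { contMDiff_mul := h.contMDiff_mul h1 hF hconj }
  have hGt : IsTopologicalGroup G := topologicalGroup_of_lieGroup I ∞
  refine { contMDiff_inv := fun e => ?_ }
  set x := e.right with hx
  have c1 : ContMDiffAt 𝓘(ℝ, V) (J.prod I) ∞ (patchCoord F x) e :=
    h.contMDiffAt_coord x e (by simpa [hx] using h1)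
  have hv : (patchCoord F x e).2 = 1 := by simp [patchCoord, hx]
  have hr : ContMDiffAt I 𝓘(ℝ, V) ∞ (fun v => (ofRight F v)⁻¹) 1 := by
    simp only [ofRight_inv]
    have a1 : ContMDiffAt I J ∞ (fun v => -F (v⁻¹, v)) (1 : G) := by
      refine (ContMDiffAt.comp (I' := I.prod I) (f := fun v : G => (v⁻¹, v)) (g := F) 1 ?_
        (contMDiffAt_id.inv.prodMk contMDiffAt_id)).neg
      rw [inv_one]; exact hF 1 h1 1 h1
    exact ContMDiffAt.comp (I' := J.prod I) (f := fun v : G => (-F (v⁻¹, v), v⁻¹)) 1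
      (h.contMDiffAt_map 1 _ (by simpa using h1)) (a1.prodMk contMDiffAt_id.inv)
  have a2 : ContMDiffAt 𝓘(ℝ, V) 𝓘(ℝ, V) ∞
      (fun e' => (ofRight F (patchCoord F x e').2)⁻¹) e := by
    refine ContMDiffAt.comp (f := fun e' => (patchCoord F x e').2)
      (g := fun v => (ofRight F v)⁻¹) e ?_ c1.snd
    rw [hv]; exact hr
  have a3 : ContMDiffAt 𝓘(ℝ, V) 𝓘(ℝ, V) ∞ (fun e' => ofLeft F (-(patchCoord F x e').1)) e :=
    ContMDiffAt.comp (f := fun e' => -(patchCoord F x e').1) e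
      (h.contMDiff_ofLeft h1).contMDiffAt c1.fst.neg
  have a4 : ContMDiffAt 𝓘(ℝ, V) 𝓘(ℝ, V) ∞ (fun e' => (ofRight F (patchCoord F x e').2)⁻¹ *
      (ofRight F x)⁻¹ * ofLeft F (-(patchCoord F x e').1)) e := (a2.mul contMDiffAt_const).mul a3
  refine a4.congr_of_eventuallyEq (Eventually.of_forall fun e' => ?_)
  have hneg : ∀ a : A, ofLeft F (-a) = (ofLeft F a)⁻¹ := fun a => by
    refine (inv_eq_of_mul_eq_one_left ?_).symm
    rw [← ofLeft_add, neg_add_cancel]; rfl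
  conv_lhs => rw [← patchMap_patchCoord x e']
  simp only [patchMap, hneg, mul_inv_rev]

end LieGroup

variable [LieGroup I ∞ G] [LieAddGroup J ∞ A] [ContMDiffSMul I J ∞ G A]

/-- The transition adds F(g, v) - F(h, h⁻¹gv). Expanding both terms at v = v₀ w by the cocycle
identity, the uncontrolled term F(gv₀, w) occurs in both, because h b = g v₀, and cancels. What is
left is F(v₀, w) and F(b, w) with v₀, b ∈ U and w near 1. -/
theorem contMDiffOn_patch_trans (h1 : 1 ∈ U)
    (hF : ∀ s ∈ U, ∀ t ∈ U, ContMDiffAt (I.prod I) J ∞ F (s, t)) (g h : G) :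
    ContMDiffOn (J.prod I) (J.prod I) ∞ ((patch F U g).symm.trans (patch F U h))
      ((patch F U g).symm.trans (patch F U h)).source := by
  rintro ⟨α, v₀⟩ hp
  obtain ⟨hv, hb⟩ := mem_patch_trans_source.1 hp
  simp only at hv hb
  set b := h⁻¹ * (g * v₀) with hbdef
  have hD : ∀ v, F (g, v) - F (h, h⁻¹ * (g * v)) =
      F (g, v₀) - F (h, b) - g • F (v₀, v₀⁻¹ * v) + h • F (b, v₀⁻¹ * v) := by
    intro v
    have e1 := F.cocycle_eq g v₀ (v₀⁻¹ * v)
    have e2 := F.cocycle_eq h b (v₀⁻¹ * v)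
    have e3 : h * b = g * v₀ := by simp [hbdef]
    have e4 : b * (v₀⁻¹ * v) = h⁻¹ * (g * v) := by simp [hbdef, mul_assoc]
    rw [mul_inv_cancel_left] at e1
    rw [e3, e4] at e2
    rw [e1, e2]; abel
  have hs : ∀ s ∈ U, ContMDiffAt I J ∞ (fun v => F (s, v₀⁻¹ * v)) v₀ := fun s hsU => by
    refine ContMDiffAt.comp (f := fun v => (s, v₀⁻¹ * v)) v₀ (g := F) ?_
      ((contMDiffAt_const : ContMDiffAt I I ∞ (fun _ : G => s) v₀).prodMk
        contMDiff_mul_left.contMDiffAt)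
    rw [inv_mul_cancel]
    exact hF s hsU 1 h1
  have hDs : ContMDiffAt I J ∞ (fun v => F (g, v) - F (h, h⁻¹ * (g * v))) v₀ := by
    simp only [hD]
    exact (contMDiffAt_const.sub
      ((contMDiffAt_const : ContMDiffAt I I ∞ (fun _ : G => g) v₀).smul (hs v₀ hv))).add
      ((contMDiffAt_const : ContMDiffAt I I ∞ (fun _ : G => h) v₀).smul (hs b hb))
  have h2 : ContMDiffAt (J.prod I) I ∞ (fun p : A × G => h⁻¹ * (g * p.2)) (α, v₀) :=
    contMDiffAt_const.mul (contMDiffAt_const.mul contMDiffAt_snd)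
  have h3 : ContMDiffAt (J.prod I) J ∞
      (fun p : A × G => p.1 + (F (g, p.2) - F (h, h⁻¹ * (g * p.2)))) (α, v₀) :=
    contMDiffAt_fst.add (ContMDiffAt.comp (g := fun v => F (g, v) - F (h, h⁻¹ * (g * v)))
      (α, v₀) hDs contMDiffAt_snd)
  refine ((h3.prodMk h2).congr_of_eventuallyEq
    (Eventually.of_forall fun p => ?_)).contMDiffWithinAt
  change patchCoord F h (patchMap F g p) = _
  simp only [patchMap_eq, patchCoord, Prod.mk.injEq, and_true]
  abel

theorem exists_hasSmoothPatches [IsTopologicalGroup G] [I.Boundaryless] [J.Boundaryless]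
    (L : (EA × EG) ≃L[ℝ] V) (hU : IsOpen U) (h1 : 1 ∈ U)
    (hF : ∀ s ∈ U, ∀ t ∈ U, ContMDiffAt (I.prod I) J ∞ F (s, t)) :
    ∃ (_ : TopologicalSpace (TwistedProduct F)) (_ : ChartedSpace V (TwistedProduct F)),
      HasSmoothPatches V I J F U := by
  obtain ⟨t, c, hman, hθ⟩ := exists_isManifold_of_patches (K := J.prod I) L (patch F U)
    (isOpen_patch_trans_source hU) (contMDiffOn_patch_trans h1 hF)
    (fun e => ⟨e.right, by simpa [patch] using h1⟩)
  have htarget : ∀ g, IsOpen (patch F U g).target := fun g =>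
    hU.preimage (f := fun p : A × G => p.2) (by fun_prop)
  exact ⟨t, c, hman, fun g => (hθ g).1,
    fun g e he => (hθ g).2.1.contMDiffAt ((hθ g).1.mem_nhds he),
    fun g p hp => (hθ g).2.2.contMDiffAt ((htarget g).mem_nhds hp)⟩

end TwistedProduct

/-! ### Topology and measurability of the twisted product -/

namespace TwistedProduct

universe u v

section Topology

variable {EG HG EA HA V : Type*} {G : Type u} {A : Type v}
  [NormedAddCommGroup EG] [NormedSpace ℝ EG] [TopologicalSpace HG]
  {I : ModelWithCorners ℝ EG HG}
  [Group G] [TopologicalSpace G] [ChartedSpace HG G]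
  [NormedAddCommGroup EA] [NormedSpace ℝ EA] [TopologicalSpace HA]
  {J : ModelWithCorners ℝ EA HA}
  [AddCommGroup A] [TopologicalSpace A] [ChartedSpace HA A] [DistribMulAction G A]
  {F : NormalizedCocycle G A} {U : Set G}
  [NormedAddCommGroup V] [NormedSpace ℝ V]
  [TopologicalSpace (TwistedProduct F)] [ChartedSpace V (TwistedProduct F)]

/-- The patches as partial homeomorphisms. -/
def HasSmoothPatches.patchHomeomorph (h : HasSmoothPatches V I J F U) (hU : IsOpen U) (g : G) :
    OpenPartialHomeomorph (TwistedProduct F) (A × G) where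
  toPartialEquiv := patch F U g
  open_source := h.isOpen_source g
  open_target := hU.preimage continuous_snd
  continuousOn_toFun := fun e he => (h.contMDiffAt_coord g e he).continuousAt.continuousWithinAt
  continuousOn_invFun := fun p hp => (h.contMDiffAt_map g p hp).continuousAt.continuousWithinAt

/-- A point outside the image of C either lies over some g ≠ 1, an open condition, or lies in the
patch at 1 with A-coordinate outside C. -/
theorem HasSmoothPatches.isClosedMap_ofLeft (h : HasSmoothPatches V I J F U) (h1 : 1 ∈ U)
    [T1Space G] (hright : Continuous (right : TwistedProduct F → G)) :
    IsClosedMap (ofLeft F) := by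
  intro C hC
  have hset : (ofLeft F '' C)ᶜ = right ⁻¹' ({1}ᶜ : Set G) ∪
      ({e | (1 : G)⁻¹ * e.right ∈ U} ∩ (fun e => (patchCoord F 1 e).1) ⁻¹' Cᶜ) := by
    ext e
    constructor
    · intro he
      by_cases hr : e.right = 1
      · refine Or.inr ⟨by simpa [hr] using h1, fun hC' => he ⟨_, hC', ?_⟩⟩
        ext <;> simp [ofLeft, patchCoord, hr, F.map_one_left]
      · exact Or.inl hr
    · rintro (hr | ⟨-, hC'⟩) ⟨a, ha, rfl⟩
      · exact hr rfl
      · refine hC' ?_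
        simpa [patchCoord, ofLeft, F.map_one_left] using ha
  rw [← isOpen_compl_iff, hset]
  refine (isOpen_compl_singleton.preimage hright).union ?_
  have hc : ContinuousOn (fun e => (patchCoord F 1 e).1)
      {e : TwistedProduct F | (1 : G)⁻¹ * e.right ∈ U} := fun e he =>
    (h.contMDiffAt_coord 1 e he).continuousAt.fst.continuousWithinAt
  exact hc.isOpen_inter_preimage (h.isOpen_source 1) hC.isOpen_compl

/-- Points over different elements of G are separated in G; points over the same element share a
patch, hence are separated in A × G. -/
theorem HasSmoothPatches.t2Space (h : HasSmoothPatches V I J F U) (h1 : 1 ∈ U)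
    (hU : IsOpen U) [T2Space G] [T2Space A]
    (hright : Continuous (right : TwistedProduct F → G)) : T2Space (TwistedProduct F) := by
  refine ⟨fun e e' hne => ?_⟩
  by_cases hr : e.right = e'.right
  · let φ := h.patchHomeomorph hU e.right
    have he : e ∈ φ.source := show e.right⁻¹ * e.right ∈ U by simpa using h1
    have he' : e' ∈ φ.source := show e.right⁻¹ * e'.right ∈ U by simpa [hr] using h1
    obtain ⟨u, v, hu, hv, heu, hev, huv⟩ := t2_separation (φ.injOn.ne he he' hne)
    refine ⟨φ.source ∩ φ ⁻¹' u, φ.source ∩ φ ⁻¹' v, φ.isOpen_inter_preimage hu,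
      φ.isOpen_inter_preimage hv, ⟨he, heu⟩, ⟨he', hev⟩, ?_⟩
    exact (huv.preimage φ).mono Set.inter_subset_right Set.inter_subset_right
  · exact separated_by_continuous hright hr

variable [IsTopologicalGroup G]

/-- Through each point e passes a section continuous at e.right: keep the A-coordinate in the patch
centred at e.right. -/
theorem HasSmoothPatches.isOpenMap_right (h : HasSmoothPatches V I J F U) (h1 : 1 ∈ U) :
    IsOpenMap (right : TwistedProduct F → G) := by
  refine IsOpenMap.of_sections fun e =>
    ⟨fun z => patchMap F e.right ((patchCoord F e.right e).1, e.right⁻¹ * z), ?_, ?_, ?_⟩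
  · have hc : Continuous fun z : G => ((patchCoord F e.right e).1, e.right⁻¹ * z) :=
      continuous_const.prodMk (continuous_const_mul _)
    exact ContinuousAt.comp
      (f := fun z : G => ((patchCoord F e.right e).1, e.right⁻¹ * z)) (x := e.right)
      (h.contMDiffAt_map _ _ (by simpa using h1)).continuousAt hc.continuousAt
  · exact patchMap_patchCoord e.right e
  · intro z
    simp [patchMap_right]

/-- Countably many translates of a neighbourhood of the identity cover the group. -/
theorem exists_countable_cover_translates [SecondCountableTopology G] (hU : IsOpen U)
    (h1 : 1 ∈ U) : ∃ s : Set G, s.Countable ∧ ∀ z : G, ∃ g ∈ s, g⁻¹ * z ∈ U := by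
  obtain ⟨s, hs, hcover⟩ := TopologicalSpace.countable_cover_nhds
    (f := fun g : G => (fun z => g⁻¹ * z) ⁻¹' U) fun g =>
      (hU.preimage (by fun_prop)).mem_nhds (by simpa using h1)
  refine ⟨s, hs, fun z => ?_⟩
  have := hcover.symm ▸ Set.mem_univ z
  obtain ⟨g, hg, hz⟩ := Set.mem_iUnion₂.1 this
  exact ⟨g, hg, hz⟩

theorem HasSmoothPatches.secondCountableTopology (h : HasSmoothPatches V I J F U) (h1 : 1 ∈ U)
    (hU : IsOpen U) [SecondCountableTopology G] [SecondCountableTopology A] :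
    SecondCountableTopology (TwistedProduct F) := by
  obtain ⟨s, hs, hcover⟩ := exists_countable_cover_translates hU h1
  have : Countable s := hs.to_subtype
  have hsc : ∀ g : s, SecondCountableTopology (h.patchHomeomorph hU (g : G)).source := fun g =>
    (h.patchHomeomorph hU (g : G)).toHomeomorphSourceTarget.secondCountableTopology
  refine TopologicalSpace.secondCountableTopology_of_countable_cover
    (U := fun g : s => (h.patchHomeomorph hU (g : G)).source)
    (fun g => (h.patchHomeomorph hU (g : G)).open_source) ?_
  refine Set.eq_univ_of_forall fun e => ?_
  obtain ⟨g, hg, he⟩ := hcover e.right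
  exact Set.mem_iUnion.2 ⟨⟨g, hg⟩, he⟩

/-- In the patch at g the canonical section has coordinates (-F(g, g⁻¹z), g⁻¹z), which are
measurable in z, and countably many patches suffice. -/
theorem HasSmoothPatches.measurable_ofRight (h : HasSmoothPatches V I J F U) (h1 : 1 ∈ U)
    (hU : IsOpen U) [SecondCountableTopology G] [SecondCountableTopology A]
    [MeasurableSpace G] [BorelSpace G] [MeasurableSpace A] [BorelSpace A]
    [IsTopologicalAddGroup A] [MeasurableSpace (TwistedProduct F)] [BorelSpace (TwistedProduct F)]
    (hF : Measurable F) : Measurable (ofRight F) := by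
  obtain ⟨s, hs, hcover⟩ := exists_countable_cover_translates hU h1
  refine measurable_of_isOpen fun O hO => ?_
  have hset : ofRight F ⁻¹' O = ⋃ g ∈ s, (fun z => (-F (g, g⁻¹ * z), g⁻¹ * z)) ⁻¹'
      ((h.patchHomeomorph hU g).target ∩ patchMap F g ⁻¹' O) := by
    ext z
    have hmap : ∀ g, patchMap F g (-F (g, g⁻¹ * z), g⁻¹ * z) = ofRight F z := fun g => by
      rw [patchMap_eq]; ext <;> simp [ofRight]
    simp only [Set.mem_iUnion, Set.mem_preimage, Set.mem_inter_iff, hmap, exists_prop]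
    constructor
    · intro hz
      obtain ⟨g, hg, hgz⟩ := hcover z
      exact ⟨g, hg, hgz, hz⟩
    · rintro ⟨g, -, -, hz⟩
      exact hz
  rw [hset]
  refine MeasurableSet.biUnion hs fun g _ => ?_
  have hm : Measurable fun z : G => (-F (g, g⁻¹ * z), g⁻¹ * z) := by
    have : Measurable fun z : G => g⁻¹ * z := (by fun_prop : Continuous fun z => g⁻¹ * z).measurable
    exact ((hF.comp (measurable_const.prodMk this)).neg).prodMk this
  exact hm ((h.patchHomeomorph hU g).symm.isOpen_inter_preimage hO).measurableSet

end Topology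

/-! ### The extension defined by a normalized cocycle -/

section Extension

variable {EG HG EA HA : Type*} {G : Type u} {A : Type v}
  [NormedAddCommGroup EG] [NormedSpace ℝ EG] [FiniteDimensional ℝ EG] [TopologicalSpace HG]
  {I : ModelWithCorners ℝ EG HG} [I.Boundaryless]
  [Group G] [TopologicalSpace G] [T2Space G] [SecondCountableTopology G]
  [MeasurableSpace G] [BorelSpace G] [ChartedSpace HG G] [LieGroup I ∞ G]
  [NormedAddCommGroup EA] [NormedSpace ℝ EA] [FiniteDimensional ℝ EA] [TopologicalSpace HA]
  {J : ModelWithCorners ℝ EA HA} [J.Boundaryless]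
  [AddCommGroup A] [TopologicalSpace A] [SecondCountableTopology A]
  [MeasurableSpace A] [BorelSpace A] [ChartedSpace HA A] [LieAddGroup J ∞ A]
  [DistribMulAction G A] [ContMDiffSMul I J ∞ G A]

/-- Conjugation by a fixed element is smooth near the identity of the twisted product of a
measurable cocycle that is smooth around the identity. -/
theorem contMDiffAt_conjDefect {F : NormalizedCocycle G A} (hF : IsLSM (I.prod I) J (1, 1) F)
    (y : G) : ContMDiffAt I J ∞ (conjDefect F y) 1 := by
  have hGt : IsTopologicalGroup G := topologicalGroup_of_lieGroup I ∞
  have hAt : IsTopologicalAddGroup A := topologicalAddGroup_of_lieAddGroup J ∞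
  obtain ⟨hFm, hFs⟩ := isLSM_iff.1 hF
  have hcm : Measurable fun v : G => y⁻¹ * v * y :=
    (by fun_prop : Continuous fun v : G => y⁻¹ * v * y).measurable
  have hm : Measurable (conjDefect F y) :=
    (hFm.comp (measurable_id.prodMk measurable_const)).sub
      (hFm.comp (measurable_const.prodMk hcm))
  -- `conjDefect F y` evaluates F near (1, y) and (y, 1), where F is only measurable, but its
  -- coboundary evaluates F near (1,1) alone.
  refine contMDiffAt_one_of_measurable hm ?_
  have hconj : ContMDiff (I.prod I) (I.prod I) ∞
      (fun p : G × G => (y⁻¹ * p.1 * y, y⁻¹ * p.2 * y)) :=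
    ((contMDiff_const.mul contMDiff_fst).mul contMDiff_const).prodMk
      ((contMDiff_const.mul contMDiff_snd).mul contMDiff_const)
  have ht : Tendsto (fun p : G × G => (y⁻¹ * p.1 * y, y⁻¹ * p.2 * y)) (𝓝 (1, 1)) (𝓝 (1, 1)) :=
    hconj.continuous.tendsto' _ _ (by simp)
  filter_upwards [hFs, ht.eventually hFs] with p hp hp'
  have h1 : ContMDiffAt (I.prod I) J ∞
      (fun p : G × G => y • F (y⁻¹ * p.1 * y, y⁻¹ * p.2 * y)) p :=
    ContMDiffAt.smul (I := I) contMDiffAt_const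
      (ContMDiffAt.comp (f := fun p : G × G => (y⁻¹ * p.1 * y, y⁻¹ * p.2 * y)) p hp'
        hconj.contMDiffAt)
  refine (hp.sub h1).congr_of_eventuallyEq (Eventually.of_forall fun q => ?_)
  exact d1_conjDefect y q.1 q.2

variable (I J) in
/-- Every normalized locally smooth measurable cocycle comes from an extension of Lie groups. -/
theorem exists_lieExtension [T2Space A] {F : NormalizedCocycle G A} (hF : IsLSM (I.prod I) J (1, 1) F) :
    ∃ (X : LieExtension I J G A) (σ : X.ext.Section), IsLSM I (𝓡 X.dim) (1 : G) σ ∧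
      ∀ s t : G, X.ext.inl (Multiplicative.ofAdd (F (s, t))) = σ s * σ t * (σ (s * t))⁻¹ := by
  have hGt : IsTopologicalGroup G := topologicalGroup_of_lieGroup I ∞
  have hAt : IsTopologicalAddGroup A := topologicalAddGroup_of_lieAddGroup J ∞
  obtain ⟨hFm, hFs⟩ := isLSM_iff.1 hF
  obtain ⟨U, hU, h1, hFU⟩ : ∃ U : Set G, IsOpen U ∧ 1 ∈ U ∧
      ∀ s ∈ U, ∀ t ∈ U, ContMDiffAt (I.prod I) J ∞ F (s, t) := by
    obtain ⟨U₁, hU₁, U₂, hU₂, h⟩ := mem_nhds_prod_iff.1 hFs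
    obtain ⟨U, hUs, hU, h1⟩ := mem_nhds_iff.1 (inter_mem hU₁ hU₂)
    exact ⟨U, hU, h1, fun s hs t ht => h (show (s, t) ∈ U₁ ×ˢ U₂ from ⟨(hUs hs).1, (hUs ht).2⟩)⟩
  let d := Module.finrank ℝ (EA × EG)
  -- `toEuclidean` moves the model A × G to the Euclidean space required by `LieExtension`.
  obtain ⟨top, ch, h⟩ := exists_hasSmoothPatches (I := I) (J := J)
    (toEuclidean : (EA × EG) ≃L[ℝ] EuclideanSpace ℝ (Fin d)) hU h1 hFU
  have hlie : LieGroup (𝓡 d) ∞ (TwistedProduct F) :=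
    h.lieGroup h1 hFU (contMDiffAt_conjDefect hF)
  have hright := h.contMDiff_right h1
  have ht2 := h.t2Space h1 hU hright.continuous
  have hsc := h.secondCountableTopology h1 hU
  let : MeasurableSpace (TwistedProduct F) := borel _
  have : BorelSpace (TwistedProduct F) := ⟨rfl⟩
  let σ : (groupExtension F).Section := ⟨ofRight F, fun _ => rfl⟩
  have hσ : IsLSM I (𝓡 d) (1 : G) σ :=
    ⟨h.measurable_ofRight h1 hU hFm, U, hU, h1,
      fun g hg => (h.contMDiffAt_ofRight hg).contMDiffWithinAt⟩
  let X : LieExtension I J G A :=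
    { carrier := TwistedProduct F
      dim := d
      ext := groupExtension F
      contMDiff_inl := h.contMDiff_ofLeft h1
      isClosedMap_inl := h.isClosedMap_ofLeft h1 hright.continuous
      contMDiff_rightHom := hright
      isOpenMap_rightHom := h.isOpenMap_right h1
      conj_inl := conj_ofLeft
      exists_section := ⟨σ, hσ⟩ }
  refine ⟨X, σ, hσ, fun s t => ?_⟩
  rw [eq_mul_inv_iff_mul_eq]
  exact (ofRight_mul_ofRight s t).symm

end Extension

end TwistedProduct
theorem d2_d1 {G A : Type*} [Group G] [AddCommGroup A] [DistribMulAction G A] (c : G → A) :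
    d2 G A (d1 G A c) = 0 := by
  ext ⟨s, t, u⟩
  simp only [d1, d2, AddMonoidHom.coe_mk, ZeroHom.coe_mk, Pi.zero_apply, smul_add, smul_sub,
    mul_smul, mul_assoc]
  abel

/-! ### From extensions to cocycles, and comparison of extensions -/

namespace LieExtension

universe u v

variable {EG HG EA HA : Type*} {G : Type u} {A : Type v}
  [NormedAddCommGroup EG] [NormedSpace ℝ EG] [TopologicalSpace HG]
  {I : ModelWithCorners ℝ EG HG}
  [Group G] [TopologicalSpace G] [MeasurableSpace G] [ChartedSpace HG G]
  [NormedAddCommGroup EA] [NormedSpace ℝ EA] [TopologicalSpace HA]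
  {J : ModelWithCorners ℝ EA HA}
  [AddCommGroup A] [TopologicalSpace A] [ChartedSpace HA A] [DistribMulAction G A]

/-- The inclusion of `A` in an extension, in additive notation. -/
def incl (X : LieExtension I J G A) (a : A) : X.carrier := X.ext.inl (Multiplicative.ofAdd a)

section Algebra

variable (X : LieExtension I J G A)

theorem incl_injective : Function.Injective X.incl := fun _ _ h =>
  Multiplicative.ofAdd.injective (X.ext.inl_injective h)

theorem incl_add (a b : A) : X.incl (a + b) = X.incl a * X.incl b := by
  simp [incl, ofAdd_add]

theorem incl_neg (a : A) : X.incl (-a) = (X.incl a)⁻¹ := by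
  simp [incl, ofAdd_neg]

theorem rightHom_incl (a : A) : X.ext.rightHom (X.incl a) = 1 := X.ext.rightHom_inl _

theorem mul_incl (e : X.carrier) (a : A) :
    e * X.incl a = X.incl (X.ext.rightHom e • a) * e := by
  rw [← mul_inv_eq_iff_eq_mul]
  exact X.conj_inl e a

theorem exists_incl_eq {e : X.carrier} (he : X.ext.rightHom e = 1) : ∃ a, X.incl a = e := by
  have h : e ∈ X.ext.inl.range := by rw [X.ext.range_inl_eq_ker_rightHom]; exact he
  obtain ⟨a, ha⟩ := h
  exact ⟨a.toAdd, ha⟩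

/-- The function `F` on `G × G` is the cocycle defined by the cross section `σ`. -/
def IsCocycleOf (σ : X.ext.Section) (F : G × G → A) : Prop :=
  ∀ s t : G, X.incl (F (s, t)) = σ s * σ t * (σ (s * t))⁻¹

variable {X}

theorem IsCocycleOf.section_mul {σ : X.ext.Section} {F : G × G → A} (h : X.IsCocycleOf σ F)
    (s t : G) : σ s * σ t = X.incl (F (s, t)) * σ (s * t) := by
  rw [h]; group

/-- Associativity of σ(s)σ(t)σ(u); the action of s appears as conjugation by σ(s). -/
theorem IsCocycleOf.d2_eq_zero {σ : X.ext.Section} {F : G × G → A} (h : X.IsCocycleOf σ F) :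
    d2 G A F = 0 := by
  ext ⟨s, t, u⟩
  have h1 : X.incl (s • F (t, u) + F (s, t * u)) = X.incl (F (s, t) + F (s * t, u)) := by
    have h2 : X.incl (s • F (t, u)) = σ s * X.incl (F (t, u)) * (σ s)⁻¹ := by
      rw [X.mul_incl, GroupExtension.Section.rightHom_section]; group
    rw [X.incl_add, X.incl_add, h2, h, h, h, h, mul_assoc s t u]
    group
  have h3 := X.incl_injective h1
  simp only [d2, AddMonoidHom.coe_mk, ZeroHom.coe_mk, Pi.zero_apply]
  rw [← sub_eq_zero] at h3
  rw [← h3]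
  abel

/-- Multiplying a cross section by a cochain. -/
def twist (X : LieExtension I J G A) (c : G → A) (σ : X.ext.Section) : X.ext.Section where
  toFun g := X.incl (c g) * σ g
  rightInverse_rightHom g := by rw [map_mul, X.rightHom_incl, one_mul, GroupExtension.Section.rightHom_section]

theorem twist_apply (c : G → A) (σ : X.ext.Section) (g : G) :
    X.twist c σ g = X.incl (c g) * σ g := rfl

theorem isCocycleOf_twist {σ : X.ext.Section} {F : G × G → A} (h : X.IsCocycleOf σ F)
    (c : G → A) : X.IsCocycleOf (X.twist c σ) (F + d1 G A c) := by
  intro s t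
  have h1 : (F + d1 G A c) (s, t) = c s + s • c t + F (s, t) + -c (s * t) := by
    simp only [Pi.add_apply, d1, AddMonoidHom.coe_mk, ZeroHom.coe_mk]; abel
  have h2 : σ s * X.incl (c t) = X.incl (s • c t) * σ s := by
    rw [X.mul_incl, GroupExtension.Section.rightHom_section]
  rw [h1, twist_apply, twist_apply, twist_apply, mul_assoc (X.incl (c s)) (σ s),
    ← mul_assoc (σ s), h2, mul_assoc (X.incl (s • c t)), h.section_mul, mul_inv_rev]
  have h3 : X.incl (-c (s * t)) = (X.incl (c (s * t)))⁻¹ := X.incl_neg _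
  rw [X.incl_add, h3, X.incl_add, X.incl_add]
  group

end Algebra

section Smooth

theorem isClosedEmbedding_incl (X : LieExtension I J G A) :
    Topology.IsClosedEmbedding X.incl :=
  .of_continuous_injective_isClosedMap X.contMDiff_inl.continuous X.incl_injective
    X.isClosedMap_inl

theorem isLSM_twist (X : LieExtension I J G A) [MeasurableSpace A] [BorelSpace A] {c : G → A}
    (hc : IsLSM I J 1 c) {σ : X.ext.Section} (hσ : IsLSM I (𝓡 X.dim) (1 : G) σ) :
    IsLSM I (𝓡 X.dim) (1 : G) (X.twist c σ) := by
  have hXt : IsTopologicalGroup X.carrier := topologicalGroup_of_lieGroup (𝓡 X.dim) ∞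
  obtain ⟨hcm, hcs⟩ := isLSM_iff.1 hc
  obtain ⟨hσm, hσs⟩ := isLSM_iff.1 hσ
  have hi : ContMDiff J (𝓡 X.dim) ∞ X.incl := X.contMDiff_inl
  refine isLSM_iff.2 ⟨(hi.continuous.measurable.comp hcm).mul hσm, ?_⟩
  filter_upwards [hcs, hσs] with g h1 h2
  exact (ContMDiffAt.comp g hi.contMDiffAt h1).mul h2

variable [FiniteDimensional ℝ EA] [J.Boundaryless] [LieAddGroup J ∞ A]

/-- The closed embedding supplies the continuity of h that the immersion argument requires. -/
theorem contMDiffAt_of_incl (X : LieExtension I J G A) {EM HM M : Type*} [NormedAddCommGroup EM]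
    [NormedSpace ℝ EM] [TopologicalSpace HM] {I' : ModelWithCorners ℝ EM HM} [TopologicalSpace M]
    [ChartedSpace HM M] {f : M → X.carrier} {h : M → A} {x : M}
    (hf : ContMDiffAt I' (𝓡 X.dim) ∞ f x) (hfh : ∀ y, X.incl (h y) = f y) :
    ContMDiffAt I' J ∞ h x := by
  refine contMDiffAt_of_comp_injective (K := 𝓡 X.dim) (i := X.incl) X.contMDiff_inl
    X.incl_injective X.incl_add hf ?_ (Eventually.of_forall hfh)
  rw [X.isClosedEmbedding_incl.isInducing.continuousAt_iff]
  exact hf.continuousAt.congr (Eventually.of_forall fun y => (hfh y).symm)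

/-- A locally smooth measurable map into the kernel of an extension lifts to `A`. -/
theorem exists_isLSM_lift (X : LieExtension I J G A) [MeasurableSpace A] [BorelSpace A]
    {EM HM M : Type*} [NormedAddCommGroup EM]
    [NormedSpace ℝ EM] [TopologicalSpace HM] {I' : ModelWithCorners ℝ EM HM} [TopologicalSpace M]
    [MeasurableSpace M] [ChartedSpace HM M] {f : M → X.carrier} {x : M}
    (hf : IsLSM I' (𝓡 X.dim) x f) (h1 : ∀ y, X.ext.rightHom (f y) = 1) :
    ∃ h : M → A, IsLSM I' J x h ∧ ∀ y, X.incl (h y) = f y := by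
  choose h hh using fun y => X.exists_incl_eq (h1 y)
  obtain ⟨hfm, hfs⟩ := isLSM_iff.1 hf
  refine ⟨h, isLSM_iff.2 ⟨?_, ?_⟩, hh⟩
  · rw [← X.isClosedEmbedding_incl.measurableEmbedding.measurable_comp_iff]
    exact (funext hh : X.incl ∘ h = f) ▸ hfm
  · filter_upwards [hfs] with y hy
    exact X.contMDiffAt_of_incl hy hh

/-- The cocycle defined by a locally smooth measurable cross section. -/
theorem exists_isCocycleOf (X : LieExtension I J G A) [MeasurableSpace A] [BorelSpace A]
    [SecondCountableTopology G] [BorelSpace G] [LieGroup I ∞ G]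
    {σ : X.ext.Section} (hσ : IsLSM I (𝓡 X.dim) (1 : G) σ) :
    ∃ F : G × G → A, IsLSM (I.prod I) J (1, 1) F ∧ X.IsCocycleOf σ F := by
  have hXt : IsTopologicalGroup X.carrier := topologicalGroup_of_lieGroup (𝓡 X.dim) ∞
  have hGt : IsTopologicalGroup G := topologicalGroup_of_lieGroup I ∞
  obtain ⟨hσm, hσs⟩ := isLSM_iff.1 hσ
  have hf : IsLSM (I.prod I) (𝓡 X.dim) (1, 1)
      (fun p : G × G => σ p.1 * σ p.2 * (σ (p.1 * p.2))⁻¹) := by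
    refine isLSM_iff.2 ⟨((hσm.comp measurable_fst).mul (hσm.comp measurable_snd)).mul
      (hσm.comp measurable_mul).inv, ?_⟩
    have t1 : Tendsto (fun p : G × G => p.1) (𝓝 (1, 1)) (𝓝 1) := continuous_fst.tendsto' _ _ rfl
    have t2 : Tendsto (fun p : G × G => p.2) (𝓝 (1, 1)) (𝓝 1) := continuous_snd.tendsto' _ _ rfl
    have t3 : Tendsto (fun p : G × G => p.1 * p.2) (𝓝 (1, 1)) (𝓝 1) :=
      continuous_mul.tendsto' _ _ (mul_one 1)
    filter_upwards [t1.eventually hσs, t2.eventually hσs, t3.eventually hσs] with p h1 h2 h3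
    exact ((ContMDiffAt.comp p h1 contMDiffAt_fst).mul (ContMDiffAt.comp p h2 contMDiffAt_snd)).mul
      (ContMDiffAt.comp (f := fun p : G × G => p.1 * p.2) p h3
        (contMDiffAt_fst.mul contMDiffAt_snd)).inv
  obtain ⟨F, hF, hFσ⟩ := X.exists_isLSM_lift hf fun p => by
    simp [GroupExtension.Section.rightHom_section]
  exact ⟨F, hF, fun s t => hFσ (s, t)⟩

/-- Equivalent extensions have cohomologous cocycles. -/
theorem exists_eq_add_d1_of_isEquivalent {X Y : LieExtension I J G A} [MeasurableSpace A]
    [BorelSpace A] (hXY : X.IsEquivalent Y) {σ : X.ext.Section} {τ : Y.ext.Section}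
    (hσ : IsLSM I (𝓡 X.dim) (1 : G) σ) (hτ : IsLSM I (𝓡 Y.dim) (1 : G) τ) {F F' : G × G → A}
    (hF : X.IsCocycleOf σ F) (hF' : Y.IsCocycleOf τ F') :
    ∃ c : G → A, IsLSM I J 1 c ∧ F = F' + d1 G A c := by
  have hYt : IsTopologicalGroup Y.carrier := topologicalGroup_of_lieGroup (𝓡 Y.dim) ∞
  obtain ⟨φ, hφ, -⟩ := hXY
  obtain ⟨hσm, hσs⟩ := isLSM_iff.1 hσ
  obtain ⟨hτm, hτs⟩ := isLSM_iff.1 hτ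
  have hf : IsLSM I (𝓡 Y.dim) (1 : G) fun g => φ (σ g) * (τ g)⁻¹ := by
    refine isLSM_iff.2 ⟨(hφ.continuous.measurable.comp hσm).mul hτm.inv, ?_⟩
    filter_upwards [hσs, hτs] with g h1 h2
    exact (ContMDiffAt.comp g hφ.contMDiffAt h1).mul h2.inv
  -- Both φ ∘ σ and τ are cross sections of Y, so their quotient lies in the kernel and lifts to A.
  -- As φ fixes A, φ ∘ σ has cocycle F, while `twist` gives it the cocycle F' + d1 c.
  obtain ⟨c, hc, hcf⟩ := Y.exists_isLSM_lift hf fun g => by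
    simp [GroupExtension.Section.rightHom_section, GroupExtension.Section.rightHom_section]
  refine ⟨c, hc, ?_⟩
  have h1 := isCocycleOf_twist hF' c
  have h2 : ∀ g, Y.twist c τ g = φ (σ g) := fun g => by rw [twist_apply, hcf]; group
  refine funext fun p => Y.incl_injective ?_
  rw [h1 p.1 p.2, h2, h2, h2, ← map_mul, ← map_inv, ← map_mul, ← hF]
  exact (φ.map_inl _).symm

/-- Two extensions with cross sections defining the same cocycle are related by a smooth
homomorphism. -/
theorem exists_hom_of_isCocycleOf {X Y : LieExtension I J G A}
    {σ : X.ext.Section} {τ : Y.ext.Section}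
    (hσ : ContMDiffAt I (𝓡 X.dim) ∞ σ (1 : G)) (hτ : ContMDiffAt I (𝓡 Y.dim) ∞ τ (1 : G))
    {F : G × G → A} (hF : X.IsCocycleOf σ F) (hF' : Y.IsCocycleOf τ F) :
    ∃ φ : X.carrier →* Y.carrier, ContMDiff (𝓡 X.dim) (𝓡 Y.dim) ∞ φ ∧
      ∀ a g, φ (X.incl a * σ g) = Y.incl a * τ g := by
  choose l hl using fun e : X.carrier => X.exists_incl_eq (e := e * (σ (X.ext.rightHom e))⁻¹)
    (by simp [GroupExtension.Section.rightHom_section])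
  have hdecomp : ∀ e, e = X.incl (l e) * σ (X.ext.rightHom e) := fun e => by rw [hl]; group
  -- The multiplication law in the coordinates (l e, π e) depends on F alone, so the same
  -- coordinates used in Y define a homomorphism.
  have hlmul : ∀ e e', l (e * e') =
      l e + X.ext.rightHom e • l e' + F (X.ext.rightHom e, X.ext.rightHom e') := by
    intro e e'
    apply X.incl_injective
    set x := X.ext.rightHom e with hx
    set y := X.ext.rightHom e' with hy
    have h2 : σ x * X.incl (l e') = X.incl (x • l e') * σ x := by
      rw [X.mul_incl, GroupExtension.Section.rightHom_section]
    rw [hl, map_mul, ← hx, ← hy, mul_inv_eq_iff_eq_mul, X.incl_add, X.incl_add]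
    conv_lhs => rw [hdecomp e, hdecomp e', ← hx, ← hy]
    rw [mul_assoc _ (X.incl (F (x, y))), ← hF.section_mul, mul_assoc (X.incl (l e)),
      ← mul_assoc (σ x), h2]
    group
  let φ : X.carrier →* Y.carrier := MonoidHom.mk'
    (fun e => Y.incl (l e) * τ (X.ext.rightHom e)) fun e e' => by
      set x := X.ext.rightHom e with hx
      set y := X.ext.rightHom e' with hy
      have h2 : τ x * Y.incl (l e') = Y.incl (x • l e') * τ x := by
        rw [Y.mul_incl, GroupExtension.Section.rightHom_section]
      simp only [hlmul, map_mul, ← hx, ← hy]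
      rw [Y.incl_add, Y.incl_add, mul_assoc _ (Y.incl (F (x, y))), ← hF'.section_mul,
        mul_assoc (Y.incl (l e)) (τ x), ← mul_assoc (τ x), h2]
      group
  have hφ : ∀ e, φ e = Y.incl (l e) * τ (X.ext.rightHom e) := fun _ => rfl
  refine ⟨φ, ?_, ?_⟩
  · have hr : ContMDiffAt (𝓡 X.dim) I ∞ X.ext.rightHom 1 := X.contMDiff_rightHom.contMDiffAt
    have hr1 : X.ext.rightHom 1 = 1 := map_one _
    have a1 : ContMDiffAt (𝓡 X.dim) (𝓡 X.dim) ∞ (fun e => e * (σ (X.ext.rightHom e))⁻¹) 1 :=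
      contMDiffAt_id.mul
        (ContMDiffAt.comp (f := X.ext.rightHom) 1 (by rw [hr1]; exact hσ) hr).inv
    have a2 : ContMDiffAt (𝓡 X.dim) J ∞ l 1 := X.contMDiffAt_of_incl a1 hl
    have hi : ContMDiff J (𝓡 Y.dim) ∞ Y.incl := Y.contMDiff_inl
    have a3 : ContMDiffAt (𝓡 X.dim) (𝓡 Y.dim) ∞ φ 1 :=
      (ContMDiffAt.comp 1 hi.contMDiffAt a2).mul
        (ContMDiffAt.comp (f := X.ext.rightHom) 1 (by rw [hr1]; exact hτ) hr)
    -- A homomorphism smooth at 1 is smooth at e, since φ e' = φ e * φ (e⁻¹ * e').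
    intro e
    have a4 : ContMDiffAt (𝓡 X.dim) (𝓡 Y.dim) ∞ (fun e' => φ e * φ (e⁻¹ * e')) e := by
      refine contMDiffAt_const.mul (ContMDiffAt.comp (f := fun e' => e⁻¹ * e') e ?_
        contMDiff_mul_left.contMDiffAt)
      rw [inv_mul_cancel]; exact a3
    refine a4.congr_of_eventuallyEq (Eventually.of_forall fun e' => ?_)
    simp only [← map_mul, mul_inv_cancel_left]
  · intro a g
    have h1 : X.ext.rightHom (X.incl a * σ g) = g := by
      rw [map_mul, X.rightHom_incl, one_mul, GroupExtension.Section.rightHom_section]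
    have h2 : l (X.incl a * σ g) = a := by
      apply X.incl_injective
      rw [hl, h1]; group
    rw [hφ, h1, h2]

/-- Two extensions with cross sections defining the same cocycle are equivalent. -/
theorem isEquivalent_of_isCocycleOf {X Y : LieExtension I J G A}
    {σ : X.ext.Section} {τ : Y.ext.Section}
    (hσ : ContMDiffAt I (𝓡 X.dim) ∞ σ (1 : G)) (hτ : ContMDiffAt I (𝓡 Y.dim) ∞ τ (1 : G))
    {F : G × G → A} (hF : X.IsCocycleOf σ F) (hF' : Y.IsCocycleOf τ F) : X.IsEquivalent Y := by
  obtain ⟨φ, hφ, hφσ⟩ := exists_hom_of_isCocycleOf hσ hτ hF hF'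
  obtain ⟨ψ, hψ, hψτ⟩ := exists_hom_of_isCocycleOf hτ hσ hF' hF
  have hX : ∀ e : X.carrier, ∃ a, e = X.incl a * σ (X.ext.rightHom e) := fun e => by
    obtain ⟨a, ha⟩ := X.exists_incl_eq (e := e * (σ (X.ext.rightHom e))⁻¹)
      (by simp [GroupExtension.Section.rightHom_section])
    exact ⟨a, by rw [ha]; group⟩
  have hY : ∀ e : Y.carrier, ∃ a, e = Y.incl a * τ (Y.ext.rightHom e) := fun e => by
    obtain ⟨a, ha⟩ := Y.exists_incl_eq (e := e * (τ (Y.ext.rightHom e))⁻¹)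
      (by simp [GroupExtension.Section.rightHom_section])
    exact ⟨a, by rw [ha]; group⟩
  let Φ : X.carrier ≃* Y.carrier :=
    { toFun := φ
      invFun := ψ
      left_inv := fun e => by
        obtain ⟨a, ha⟩ := hX e
        rw [ha, hφσ, hψτ]
      right_inv := fun e => by
        obtain ⟨a, ha⟩ := hY e
        rw [ha, hψτ, hφσ]
      map_mul' := map_mul φ }
  refine ⟨⟨Φ, ?_, ?_⟩, hφ, hψ⟩
  · funext a
    -- F is not normalized here, so an element a of A has coordinates (a - F (1, 1), 1).
    have h1 : σ 1 = X.incl (F (1, 1)) := by rw [hF]; simp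
    have h2 : τ 1 = Y.incl (F (1, 1)) := by rw [hF']; simp
    have h3 := hφσ (a.toAdd - F (1, 1)) 1
    rw [h1, h2, ← X.incl_add, ← Y.incl_add, sub_add_cancel] at h3
    exact h3
  · funext e
    obtain ⟨a, ha⟩ := hX e
    change Y.ext.rightHom (φ e) = X.ext.rightHom e
    conv_lhs => rw [ha]
    rw [hφσ, map_mul, Y.rightHom_incl, one_mul, GroupExtension.Section.rightHom_section]

end Smooth

end LieExtension

/-! ### Cohomology classes and normalization -/

section Cohomology

universe u v

variable {EG HG EA HA : Type*} {G : Type u} {A : Type v}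
  [NormedAddCommGroup EG] [NormedSpace ℝ EG] [TopologicalSpace HG]
  {I : ModelWithCorners ℝ EG HG}
  [Group G] [TopologicalSpace G] [MeasurableSpace G] [ChartedSpace HG G]
  [NormedAddCommGroup EA] [NormedSpace ℝ EA] [TopologicalSpace HA]
  {J : ModelWithCorners ℝ EA HA}
  [AddCommGroup A] [TopologicalSpace A] [SecondCountableTopology A]
  [MeasurableSpace A] [BorelSpace A] [ChartedSpace HA A] [LieAddGroup J ∞ A]
  [DistribMulAction G A]

theorem H2lsm_mk_eq_iff {F F' : Z2lsm I J G A} :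
    (QuotientAddGroup.mk F : H2lsm I J G A) = QuotientAddGroup.mk F' ↔
      ∃ c : G → A, IsLSM I J 1 c ∧ F'.1 = F.1 + d1 G A c := by
  rw [QuotientAddGroup.eq, AddSubgroup.mem_addSubgroupOf]
  constructor
  · rintro ⟨c, hc, h⟩
    refine ⟨c, hc, ?_⟩
    rw [h]
    simp
  · rintro ⟨c, hc, h⟩
    refine ⟨c, hc, ?_⟩
    simp [h]

/-- A cocycle of the given class that vanishes at the identity. -/
theorem exists_normalizedCocycle [IsTopologicalGroup G] [SecondCountableTopology G] [BorelSpace G]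
    [ContMDiffSMul I J ∞ G A] (F : Z2lsm I J G A) :
    ∃ (N : NormalizedCocycle G A), IsLSM (I.prod I) J (1, 1) N ∧
      F.1 = (N : G × G → A) + d1 G A (fun _ => F.1 (1, 1)) := by
  -- The coboundary of a constant a is s • a, which is smooth everywhere and equals a at (1,1);
  -- taking a = F(1,1) normalizes F within its class.
  have hd : d1 G A (fun _ => F.1 (1, 1)) = fun p : G × G => p.1 • F.1 (1, 1) := by
    ext p; simp [d1]
  refine ⟨⟨F.1 - d1 G A fun _ => F.1 (1, 1), ?_, ?_⟩, ?_, ?_⟩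
  · rw [map_sub, d2_d1, sub_zero]
    exact F.2.2
  · simp [hd]
  · refine (C2lsm I J G A).sub_mem F.2.1 ?_
    have hs : ContMDiff (I.prod I) J ∞ fun p : G × G => p.1 • F.1 (1, 1) :=
      contMDiff_fst.smul contMDiff_const
    rw [hd]
    exact isLSM_iff.2 ⟨hs.continuous.measurable, Eventually.of_forall fun p => hs.contMDiffAt⟩
  · simp

end Cohomology

end LocallySmooth

/-! ### The bijection -/

theorem mainTheorem3
    {EG HG EA HA G A : Type*}
    -- a Lie group `G`
    [NormedAddCommGroup EG] [NormedSpace ℝ EG] [FiniteDimensional ℝ EG] [TopologicalSpace HG]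
    (I : ModelWithCorners ℝ EG HG) [I.Boundaryless]
    [Group G] [TopologicalSpace G] [T2Space G] [SecondCountableTopology G]
    [MeasurableSpace G] [BorelSpace G] [ChartedSpace HG G] [LieGroup I ∞ G]
    -- a smooth `G`-module `A`
    [NormedAddCommGroup EA] [NormedSpace ℝ EA] [FiniteDimensional ℝ EA] [TopologicalSpace HA]
    (J : ModelWithCorners ℝ EA HA) [J.Boundaryless]
    [AddCommGroup A] [TopologicalSpace A] [T2Space A] [SecondCountableTopology A]
    [MeasurableSpace A] [BorelSpace A] [ChartedSpace HA A] [LieAddGroup J ∞ A]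
    [DistribMulAction G A] [ContMDiffSMul I J ∞ G A] :
    ∃ Φ : LocallySmooth.ExtClass I J G A ≃ LocallySmooth.H2lsm I J G A,
      ∀ (X : LocallySmooth.LieExtension I J G A) (σ : X.ext.Section),
        LocallySmooth.IsLSM I (𝓡 X.dim) (1 : G) σ →
          ∃ F : LocallySmooth.Z2lsm I J G A,
            (∀ s t : G,
              X.ext.inl (Multiplicative.ofAdd (F.1 (s, t))) = σ s * σ t * (σ (s * t))⁻¹) ∧
            Φ X.toClass = QuotientAddGroup.mk F := by
  have hG : IsTopologicalGroup G := topologicalGroup_of_lieGroup I ∞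
  have hcocycle : ∀ (X : LocallySmooth.LieExtension I J G A) (σ : X.ext.Section),
      LocallySmooth.IsLSM I (𝓡 X.dim) (1 : G) σ →
        ∃ F : LocallySmooth.Z2lsm I J G A, X.IsCocycleOf σ F.1 := fun X σ hσ => by
    obtain ⟨F, hF, hFσ⟩ := X.exists_isCocycleOf hσ
    exact ⟨⟨F, hF, hFσ.d2_eq_zero⟩, hFσ⟩
  have hwell : ∀ (X Y : LocallySmooth.LieExtension I J G A) (σ : X.ext.Section)
      (τ : Y.ext.Section) (F F' : LocallySmooth.Z2lsm I J G A), X.IsEquivalent Y →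
      LocallySmooth.IsLSM I (𝓡 X.dim) (1 : G) σ → LocallySmooth.IsLSM I (𝓡 Y.dim) (1 : G) τ →
      X.IsCocycleOf σ F.1 → Y.IsCocycleOf τ F'.1 →
      (QuotientAddGroup.mk F : LocallySmooth.H2lsm I J G A) = QuotientAddGroup.mk F' := by
    intro X Y σ τ F F' hXY hσ hτ hF hF'
    exact (LocallySmooth.H2lsm_mk_eq_iff.2
      (LocallySmooth.LieExtension.exists_eq_add_d1_of_isEquivalent hXY hσ hτ hF hF')).symm
  choose σ hσ using fun X : LocallySmooth.LieExtension I J G A => X.exists_section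
  choose F hF using fun X : LocallySmooth.LieExtension I J G A => hcocycle X (σ X) (hσ X)
  let Φ : LocallySmooth.ExtClass I J G A → LocallySmooth.H2lsm I J G A :=
    Quotient.lift (fun X => QuotientAddGroup.mk (F X)) fun X Y hXY =>
      hwell X Y _ _ _ _ hXY (hσ X) (hσ Y) (hF X) (hF Y)
  -- Reflexivity of equivalence turns `hwell` into independence of the cross section.
  have hΦ : ∀ (X : LocallySmooth.LieExtension I J G A) (τ : X.ext.Section)
      (F' : LocallySmooth.Z2lsm I J G A), LocallySmooth.IsLSM I (𝓡 X.dim) (1 : G) τ →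
      X.IsCocycleOf τ F'.1 → Φ X.toClass = QuotientAddGroup.mk F' := fun X τ F' hτ hF' =>
    hwell X X _ _ _ _ ((LocallySmooth.LieExtension.setoid I J G A).refl X) (hσ X) hτ (hF X) hF'
  have hinj : Function.Injective Φ := by
    intro x y
    refine Quotient.inductionOn₂ x y fun X Y hXY => Quotient.sound ?_
    obtain ⟨c, hc, hFc⟩ := LocallySmooth.H2lsm_mk_eq_iff.1 hXY
    -- Twisting the cross section of X by c makes its cocycle equal to that of Y, not merely
    -- cohomologous to it.
    have hX : X.IsCocycleOf (X.twist c (σ X)) (F Y).1 :=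
      hFc ▸ LocallySmooth.LieExtension.isCocycleOf_twist (hF X) c
    have hXσ := X.isLSM_twist hc (hσ X)
    exact LocallySmooth.LieExtension.isEquivalent_of_isCocycleOf
      (LocallySmooth.isLSM_iff.1 hXσ).2.self_of_nhds
      (LocallySmooth.isLSM_iff.1 (hσ Y)).2.self_of_nhds hX (hF Y)
  have hsurj : Function.Surjective Φ := by
    intro z
    induction z using QuotientAddGroup.induction_on with
    | H Z =>
      obtain ⟨N, hN, hZ⟩ := LocallySmooth.exists_normalizedCocycle Z
      obtain ⟨X, τ, hτ, hXτ⟩ := LocallySmooth.TwistedProduct.exists_lieExtension I J hN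
      refine ⟨X.toClass, ?_⟩
      have hNτ : X.IsCocycleOf τ N := hXτ
      rw [hΦ X τ ⟨N, hN, hNτ.d2_eq_zero⟩ hτ hNτ]
      refine LocallySmooth.H2lsm_mk_eq_iff.2 ⟨fun _ => Z.1 (1, 1), ?_, hZ⟩
      exact ⟨measurable_const, Set.univ, isOpen_univ, Set.mem_univ _, contMDiffOn_const⟩
  refine ⟨Equiv.ofBijective Φ ⟨hinj, hsurj⟩, fun X τ hτ => ?_⟩
  obtain ⟨F', hF'⟩ := hcocycle X τ hτ
  exact ⟨F', hF', hΦ X τ F' hτ hF'⟩
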